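/- Let $\mathcal{M}$ be a smooth (Hausdorff, finite-dimensional, boundaryless) Riemannian manifold and let $f \colon \mathcal{M} \to \mathbb{R}$ be twice differentiable, that is, $f$ is differentiable and its Riemannian gradient $\mathrm{grad} f$ is a differentiable vector field. Let $\mathrm{Hess} f = \nabla\, \mathrm{grad} f$ denote the Riemannian Hessian, where $\nabla$ is the Riemannian (Levi-Civita) connection. Let $\mathrm{Exp}_x(s) = \gamma(1)$ be the exponential map, where $\gamma$ is the geodesic with $\gamma(0) = x$ and $\gamma'(0) = s$; the pair $(x, s)$ is in the domain of $\mathrm{Exp}$ if this geodesic is defined on $[0, 1]$. For $(x, s)$ in the domain of $\mathrm{Exp}$, let $P_s \colon \mathrm{T}_x\mathcal{M} \to \mathrm{T}_{\mathrm{Exp}_x(s)}\mathcal{M}$ denote parallel transport along the geodesic $t \mapsto \mathrm{Exp}_x(ts)$ from $t = 0$ to $t = 1$. Let $(x, s)$ be in the domain of $\mathrm{Exp}$ and let $L \geq 0$ be such that, for all $t \in [0, 1]$, $$\left\| P_{ts}^{-1} \circ \mathrm{Hess} f(\mathrm{Exp}_x(ts)) \circ P_{ts} - \mathrm{Hess}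 f(x) \right\|_{\mathrm{op}} \leq L \|ts\|.$$ Then the following two inequalities hold: $$\left| f(\mathrm{Exp}_x(s)) - f(x) - \langle s, \mathrm{grad} f(x) \rangle - \tfrac{1}{2} \langle s, \mathrm{Hess} f(x)[s] \rangle \right| \leq \frac{L}{6} \|s\|^3,$$ $$\left\| P_s^{-1} \mathrm{grad} f(\mathrm{Exp}_x(s)) - \mathrm{grad} f(x) - \mathrm{Hess} f(x)[s] \right\| \leq \frac{L}{2} \|s\|^2.$$ -/

import Mathlib

open Set Bundle
open scoped Manifold ContDiff Topology

noncomputable section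

namespace RiemannianTaylor

set_option linter.unusedSectionVars false

section Vectors

variable {E : Type*} [NormedAddCommGroup E] [NormedSpace ℝ E]
  {M : Type*} [TopologicalSpace M] [ChartedSpace E M] [IsManifold 𝓘(ℝ, E) ∞ M]

/-- The coordinates, in the chart at `x`, of a tangent vector `w` (at a point near `x`). -/
def coord (x : M) (w : TangentBundle 𝓘(ℝ, E) M) : E :=
  (trivializationAt E (TangentSpace 𝓘(ℝ, E) (M := M)) x w).2

/-- The vector field which, near `x`, has constant coordinates in the chart at `x`, and whose value
at `x` is `v`. -/
def coordField (x : M) (v : TangentSpace 𝓘(ℝ, E) x) (q : M) : TangentSpace 𝓘(ℝ, E) q :=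
  (trivializationAt E (TangentSpace 𝓘(ℝ, E) (M := M)) x).symmL ℝ q v

theorem coord_self (x : M) (v : TangentSpace 𝓘(ℝ, E) x) : coord x ⟨x, v⟩ = v := by
  exact (tangentBundleCore 𝓘(ℝ, E) M).coordChange_self (achart E x) x (mem_achart_source E x) v

theorem coordField_eq_extend {x q : M} (hq : q ∈ (chartAt E x).source)
    (v : TangentSpace 𝓘(ℝ, E) x) :
    coordField x v q =
      FiberBundle.extend (E := fun y : M ↦ TangentSpace 𝓘(ℝ, E) y) E v q := by
  have h := coord_self x v
  unfold coord at h
  simp only [coordField, FiberBundle.extend]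
  rw [h]
  exact (trivializationAt E (TangentSpace 𝓘(ℝ, E) (M := M)) x).symmL_apply hq v

theorem coordField_eventuallyEq_extend (x : M) (v : TangentSpace 𝓘(ℝ, E) x) :
    ∀ᶠ q in 𝓝 x, coordField x v q =
      FiberBundle.extend (E := fun y : M ↦ TangentSpace 𝓘(ℝ, E) y) E v q := by
  filter_upwards [(chartAt E x).open_source.mem_nhds (mem_chart_source E x)] with q hq
  exact coordField_eq_extend hq v

theorem mvfderiv_congr {F : Type*} [NormedAddCommGroup F] [NormedSpace ℝ F] {f g : M → F} {x : M}
    (h : f =ᶠ[𝓝 x] g) : mvfderiv 𝓘(ℝ, E) f x = mvfderiv 𝓘(ℝ, E) g x := by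
  ext u
  have h1 := h.mfderiv_eq (I := 𝓘(ℝ, E)) (I' := 𝓘(ℝ, F))
  exact congrArg (fun A : E →L[ℝ] F ↦ A u) h1

theorem coordField_self (x : M) (v : TangentSpace 𝓘(ℝ, E) x) : coordField x v x = v := by
  rw [coordField_eq_extend (mem_chart_source E x), FiberBundle.extend_apply_self]

theorem coordField_add (x : M) (v w : TangentSpace 𝓘(ℝ, E) x) (q : M) :
    coordField x (v + w) q = coordField x v q + coordField x w q :=
  map_add ((trivializationAt E (TangentSpace 𝓘(ℝ, E) (M := M)) x).symmL ℝ q) v w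

theorem coordField_smul (x : M) (a : ℝ) (v : TangentSpace 𝓘(ℝ, E) x) (q : M) :
    coordField x (a • v) q = a • coordField x v q :=
  map_smul ((trivializationAt E (TangentSpace 𝓘(ℝ, E) (M := M)) x).symmL ℝ q) a v

theorem mdifferentiableAt_coordField (x : M) (v : TangentSpace 𝓘(ℝ, E) x) :
    MDifferentiableAt 𝓘(ℝ, E) (𝓘(ℝ, E).prod 𝓘(ℝ, E))
      (fun q ↦ TotalSpace.mk' E (E := fun y : M ↦ TangentSpace 𝓘(ℝ, E) y) q
        (coordField x v q)) x := by
  refine (FiberBundle.mdifferentiableAt_extend 𝓘(ℝ, E) E v).congr_of_eventuallyEq ?_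
  filter_upwards [coordField_eventuallyEq_extend x v] with q hq
  rw [hq]

theorem mdifferentiableAt_coord {Y : Π x : M, TangentSpace 𝓘(ℝ, E) x} {x : M}
    (hY : MDifferentiableAt 𝓘(ℝ, E) (𝓘(ℝ, E).prod 𝓘(ℝ, E))
      (fun q ↦ TotalSpace.mk' E (E := fun y : M ↦ TangentSpace 𝓘(ℝ, E) y) q (Y q)) x) :
    MDifferentiableAt 𝓘(ℝ, E) 𝓘(ℝ, E) (fun q : M ↦ coord x ⟨q, Y q⟩) x :=
  ((mdifferentiableAt_totalSpace ..).1 hY).2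

theorem coord_add {x q : M} (hq : q ∈ (chartAt E x).source) (v w : TangentSpace 𝓘(ℝ, E) q) :
    coord x ⟨q, v + w⟩ = coord x ⟨q, v⟩ + coord x ⟨q, w⟩ :=
  ((trivializationAt E (TangentSpace 𝓘(ℝ, E) (M := M)) x).linear ℝ hq).map_add v w

theorem coord_smul {x q : M} (hq : q ∈ (chartAt E x).source) (a : ℝ)
    (v : TangentSpace 𝓘(ℝ, E) q) : coord x ⟨q, a • v⟩ = a • coord x ⟨q, v⟩ :=
  ((trivializationAt E (TangentSpace 𝓘(ℝ, E) (M := M)) x).linear ℝ hq).map_smul a v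

end Vectors

section Metric

variable {E : Type*} [NormedAddCommGroup E] [NormedSpace ℝ E] [FiniteDimensional ℝ E]
  {M : Type*} [TopologicalSpace M] [ChartedSpace E M] [IsManifold 𝓘(ℝ, E) ∞ M]
  [RiemannianBundle (fun x : M ↦ TangentSpace 𝓘(ℝ, E) x)]

instance instFiniteDimensionalTangentSpace (x : M) :
    FiniteDimensional ℝ (TangentSpace 𝓘(ℝ, E) x) :=
  inferInstanceAs (FiniteDimensional ℝ E)

instance instCompleteSpaceTangentSpace (x : M) : CompleteSpace (TangentSpace 𝓘(ℝ, E) x) :=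
  FiniteDimensional.complete ℝ _

/-- The derivative at `x`, in the direction `u`, of the metric coefficient `g(v, w)`, read in the
chart at `x`. -/
def metricDeriv (x : M) (u v w : TangentSpace 𝓘(ℝ, E) x) : ℝ :=
  mvfderiv 𝓘(ℝ, E) (fun q : M ↦ inner ℝ (coordField x v q) (coordField x w q)) x u

/-- The Christoffel symbol `Γ(u, v)` of the metric at `x`, in the chart at `x`: it is the vector
such that `g(Γ(u, v), w) = (∂_u g(v, w) + ∂_v g(u, w) - ∂_w g(u, v)) / 2` for all `w`. -/
def christoffel (x : M) (u v : TangentSpace 𝓘(ℝ, E) x) : TangentSpace 𝓘(ℝ, E) x :=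
  let e := stdOrthonormalBasis ℝ (TangentSpace 𝓘(ℝ, E) x)
  ∑ i, ((metricDeriv x u v (e i) + metricDeriv x v u (e i) - metricDeriv x (e i) u v) / 2) • e i

theorem metricDeriv_add_left (x : M) (u u' v w : TangentSpace 𝓘(ℝ, E) x) :
    metricDeriv x (u + u') v w = metricDeriv x u v w + metricDeriv x u' v w := by
  simp [metricDeriv]

theorem metricDeriv_smul_left (x : M) (a : ℝ) (u v w : TangentSpace 𝓘(ℝ, E) x) :
    metricDeriv x (a • u) v w = a * metricDeriv x u v w := by
  simp [metricDeriv]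

theorem metricDeriv_comm (x : M) (u v w : TangentSpace 𝓘(ℝ, E) x) :
    metricDeriv x u v w = metricDeriv x u w v := by
  simp [metricDeriv, real_inner_comm]

theorem christoffel_symm (x : M) (u v : TangentSpace 𝓘(ℝ, E) x) :
    christoffel x u v = christoffel x v u := by
  simp only [christoffel]
  refine Finset.sum_congr rfl fun i _ ↦ ?_
  rw [metricDeriv_comm x _ u v, add_comm (metricDeriv x u v _)]

variable [IsContMDiffRiemannianBundle 𝓘(ℝ, E) ∞ E (fun x : M ↦ TangentSpace 𝓘(ℝ, E) x)]

theorem mdifferentiableAt_inner {Y Z : Π x : M, TangentSpace 𝓘(ℝ, E) x} {x : M}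
    (hY : MDifferentiableAt 𝓘(ℝ, E) (𝓘(ℝ, E).prod 𝓘(ℝ, E))
      (fun q ↦ TotalSpace.mk' E (E := fun y : M ↦ TangentSpace 𝓘(ℝ, E) y) q (Y q)) x)
    (hZ : MDifferentiableAt 𝓘(ℝ, E) (𝓘(ℝ, E).prod 𝓘(ℝ, E))
      (fun q ↦ TotalSpace.mk' E (E := fun y : M ↦ TangentSpace 𝓘(ℝ, E) y) q (Z q)) x) :
    MDifferentiableAt 𝓘(ℝ, E) 𝓘(ℝ) (fun q : M ↦ inner ℝ (Y q) (Z q)) x :=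
  MDifferentiableAt.inner_bundle hY hZ

theorem mdifferentiableAt_inner_coordField (x : M) (v w : TangentSpace 𝓘(ℝ, E) x) :
    MDifferentiableAt 𝓘(ℝ, E) 𝓘(ℝ)
      (fun q : M ↦ inner ℝ (coordField x v q) (coordField x w q)) x :=
  mdifferentiableAt_inner (mdifferentiableAt_coordField x v) (mdifferentiableAt_coordField x w)

theorem metricDeriv_add_mid (x : M) (u v v' w : TangentSpace 𝓘(ℝ, E) x) :
    metricDeriv x u (v + v') w = metricDeriv x u v w + metricDeriv x u v' w := by
  simp only [metricDeriv, coordField_add, inner_add_left]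
  rw [mvfderiv_fun_add (mdifferentiableAt_inner_coordField x v w)
    (mdifferentiableAt_inner_coordField x v' w)]
  rfl

theorem metricDeriv_smul_mid (x : M) (a : ℝ) (u v w : TangentSpace 𝓘(ℝ, E) x) :
    metricDeriv x u (a • v) w = a * metricDeriv x u v w := by
  simp only [metricDeriv, coordField_smul, real_inner_smul_left]
  rw [mvfderiv_fun_mul mdifferentiableAt_const (mdifferentiableAt_inner_coordField x v w)]
  simp [mvfderiv_const]

theorem christoffel_add_left (x : M) (u u' v : TangentSpace 𝓘(ℝ, E) x) :
    christoffel x (u + u') v = christoffel x u v + christoffel x u' v := by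
  simp only [christoffel, ← Finset.sum_add_distrib, ← add_smul]
  refine Finset.sum_congr rfl fun i _ ↦ ?_
  rw [metricDeriv_add_left, metricDeriv_add_mid, metricDeriv_add_mid]
  congr 1
  ring

theorem christoffel_smul_left (x : M) (a : ℝ) (u v : TangentSpace 𝓘(ℝ, E) x) :
    christoffel x (a • u) v = a • christoffel x u v := by
  simp only [christoffel, Finset.smul_sum, smul_smul]
  refine Finset.sum_congr rfl fun i _ ↦ ?_
  rw [metricDeriv_smul_left, metricDeriv_smul_mid, metricDeriv_smul_mid]
  congr 1
  ring

/-- `christoffel` as a continuous linear map in its first argument: `u ↦ Γ(u, v)`. -/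
def christoffelMap (x : M) (v : TangentSpace 𝓘(ℝ, E) x) :
    TangentSpace 𝓘(ℝ, E) x →L[ℝ] TangentSpace 𝓘(ℝ, E) x :=
  LinearMap.toContinuousLinearMap
    { toFun := fun u ↦ christoffel x u v
      map_add' := fun u u' ↦ christoffel_add_left x u u' v
      map_smul' := fun a u ↦ christoffel_smul_left x a u v }

theorem christoffelMap_apply (x : M) (v u : TangentSpace 𝓘(ℝ, E) x) :
    christoffelMap x v u = christoffel x u v := rfl

/-- The derivative at `x` of the coordinates of the vector field `Y` in the chart at `x`. -/
def coordDeriv (Y : Π x : M, TangentSpace 𝓘(ℝ, E) x) (x : M) :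
    TangentSpace 𝓘(ℝ, E) x →L[ℝ] TangentSpace 𝓘(ℝ, E) x :=
  mvfderiv 𝓘(ℝ, E) (fun q : M ↦ coord x ⟨q, Y q⟩) x

theorem coordDeriv_add {σ σ' : Π x : M, TangentSpace 𝓘(ℝ, E) x} {x : M}
    (hσ : MDifferentiableAt 𝓘(ℝ, E) (𝓘(ℝ, E).prod 𝓘(ℝ, E))
      (fun q ↦ TotalSpace.mk' E (E := fun y : M ↦ TangentSpace 𝓘(ℝ, E) y) q (σ q)) x)
    (hσ' : MDifferentiableAt 𝓘(ℝ, E) (𝓘(ℝ, E).prod 𝓘(ℝ, E))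
      (fun q ↦ TotalSpace.mk' E (E := fun y : M ↦ TangentSpace 𝓘(ℝ, E) y) q (σ' q)) x) :
    coordDeriv (σ + σ') x = coordDeriv σ x + coordDeriv σ' x := by
  have h : (fun q : M ↦ coord x ⟨q, (σ + σ') q⟩) =ᶠ[𝓝 x]
      (fun q : M ↦ coord x ⟨q, σ q⟩ + coord x ⟨q, σ' q⟩) := by
    filter_upwards [(chartAt E x).open_source.mem_nhds (mem_chart_source E x)] with q hq
    exact coord_add hq _ _
  have h1 := mvfderiv_fun_add (mdifferentiableAt_coord hσ) (mdifferentiableAt_coord hσ')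
  ext u
  have h2 := congrArg (fun A ↦ A u) h1
  simp only [coordDeriv]
  rw [mvfderiv_congr h]
  exact h2

theorem coordDeriv_smul {σ : Π x : M, TangentSpace 𝓘(ℝ, E) x} {g : M → ℝ} {x : M}
    (hσ : MDifferentiableAt 𝓘(ℝ, E) (𝓘(ℝ, E).prod 𝓘(ℝ, E))
      (fun q ↦ TotalSpace.mk' E (E := fun y : M ↦ TangentSpace 𝓘(ℝ, E) y) q (σ q)) x)
    (hg : MDifferentiableAt 𝓘(ℝ, E) 𝓘(ℝ) g x) :
    coordDeriv (g • σ) x = g x • coordDeriv σ x + (mvfderiv 𝓘(ℝ, E) g x).smulRight (σ x) := by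
  have h : (fun q : M ↦ coord x ⟨q, (g • σ) q⟩) =ᶠ[𝓝 x]
      (g • fun q : M ↦ coord x ⟨q, σ q⟩) := by
    filter_upwards [(chartAt E x).open_source.mem_nhds (mem_chart_source E x)] with q hq
    exact coord_smul hq _ _
  have h1 := mvfderiv_smul hg (mdifferentiableAt_coord hσ)
  rw [coord_self] at h1
  ext u
  have h2 := congrArg (fun A ↦ A u) h1
  simp only [coordDeriv]
  rw [mvfderiv_congr h]
  exact h2

/-- The Riemannian (Levi-Civita) connection: `∇_u Y (x) = DY(x)[u] + Γ(u, Y x)` in the chart at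
`x`. -/
def leviCivita : CovariantDerivative 𝓘(ℝ, E) E (fun x : M ↦ TangentSpace 𝓘(ℝ, E) x) where
  toFun Y x := coordDeriv Y x + christoffelMap x (Y x)
  isCovariantDerivativeOnUniv :=
    { add := by
        intro σ σ' x hσ hσ' _
        ext u
        simp only [coordDeriv_add hσ hσ', Pi.add_apply, add_apply,
          christoffelMap_apply, christoffel_symm x u, christoffel_add_left]
        exact add_add_add_comm _ _ _ _
      leibniz := by
        intro σ g x hσ hg _
        ext u
        simp only [coordDeriv_smul hσ hg, Pi.smul_apply', add_apply,
          smul_apply,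
          christoffelMap_apply, christoffel_symm x u, christoffel_smul_left, smul_add]
        exact add_right_comm _ _ _ }

theorem leviCivita_apply (Y : Π x : M, TangentSpace 𝓘(ℝ, E) x) (x : M)
    (u : TangentSpace 𝓘(ℝ, E) x) :
    leviCivita Y x u = coordDeriv Y x u + christoffel x u (Y x) := rfl

theorem coordDeriv_coordField (x : M) (v : TangentSpace 𝓘(ℝ, E) x) :
    coordDeriv (coordField x v) x = 0 := by
  have h : (fun q : M ↦ coord x ⟨q, coordField x v q⟩) =ᶠ[𝓝 x] (fun _ : M ↦ (v : E)) := by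
    filter_upwards [(chartAt E x).open_source.mem_nhds (mem_chart_source E x)] with q hq
    have h1 := (trivializationAt E (TangentSpace 𝓘(ℝ, E) (M := M)) x).continuousLinearMapAt_symmL
      (R := ℝ) hq v
    rwa [Trivialization.continuousLinearMapAt_apply_of_mem _ _ hq] at h1
  ext u
  have h2 := congrArg (fun A ↦ A u) (mvfderiv_const (I := 𝓘(ℝ, E)) (v : E) (x := x))
  simp only [coordDeriv]
  rw [mvfderiv_congr h]
  exact h2

/-- The defining property of the Christoffel symbols. -/
theorem inner_christoffel (x : M) (u v w : TangentSpace 𝓘(ℝ, E) x) :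
    inner ℝ (christoffel x u v) w =
      (metricDeriv x u v w + metricDeriv x v u w - metricDeriv x w u v) / 2 := by
  let φ : TangentSpace 𝓘(ℝ, E) x →ₗ[ℝ] ℝ :=
    { toFun := fun w ↦ (metricDeriv x u v w + metricDeriv x v u w - metricDeriv x w u v) / 2
      map_add' := fun w w' ↦ by
        rw [metricDeriv_comm x u v, metricDeriv_comm x v u, metricDeriv_add_left,
          metricDeriv_add_mid, metricDeriv_add_mid, metricDeriv_comm x u v w,
          metricDeriv_comm x v u w, metricDeriv_comm x u v w', metricDeriv_comm x v u w']
        ring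
      map_smul' := fun a w ↦ by
        rw [metricDeriv_comm x u v, metricDeriv_comm x v u, metricDeriv_smul_left,
          metricDeriv_smul_mid, metricDeriv_smul_mid, metricDeriv_comm x u v w,
          metricDeriv_comm x v u w]
        simp only [RingHom.id_apply, smul_eq_mul]
        ring }
  have hw := (stdOrthonormalBasis ℝ (TangentSpace 𝓘(ℝ, E) x)).sum_repr' w
  change _ = φ w
  conv_rhs => rw [← hw, map_sum]
  rw [christoffel, sum_inner]
  refine Finset.sum_congr rfl fun i _ ↦ ?_
  rw [map_smul, real_inner_smul_left, smul_eq_mul, mul_comm]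
  rfl

/-- `leviCivita` is compatible with the metric. -/
theorem leviCivita_inner {Y Z : Π x : M, TangentSpace 𝓘(ℝ, E) x} {x : M}
    (hY : MDifferentiableAt 𝓘(ℝ, E) (𝓘(ℝ, E).prod 𝓘(ℝ, E))
      (fun q ↦ TotalSpace.mk' E (E := fun y : M ↦ TangentSpace 𝓘(ℝ, E) y) q (Y q)) x)
    (hZ : MDifferentiableAt 𝓘(ℝ, E) (𝓘(ℝ, E).prod 𝓘(ℝ, E))
      (fun q ↦ TotalSpace.mk' E (E := fun y : M ↦ TangentSpace 𝓘(ℝ, E) y) q (Z q)) x)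
    (u : TangentSpace 𝓘(ℝ, E) x) :
    mvfderiv 𝓘(ℝ, E) (fun q : M ↦ inner ℝ (Y q) (Z q)) x u =
      inner ℝ (leviCivita Y x u) (Z x) + inner ℝ (Y x) (leviCivita Z x u) := by
  let Φ (Y Z : Π x : M, TangentSpace 𝓘(ℝ, E) x) : ℝ :=
    mvfderiv 𝓘(ℝ, E) (fun q : M ↦ inner ℝ (Y q) (Z q)) x u
      - inner ℝ (leviCivita Y x u) (Z x) - inner ℝ (Y x) (leviCivita Z x u)
  have hsymm : ∀ Y Z, Φ Y Z = Φ Z Y := by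
    intro Y Z
    simp only [Φ, real_inner_comm]
    ring
  have htens : ∀ Z : Π x : M, TangentSpace 𝓘(ℝ, E) x,
      MDifferentiableAt 𝓘(ℝ, E) (𝓘(ℝ, E).prod 𝓘(ℝ, E))
        (fun q ↦ TotalSpace.mk' E (E := fun y : M ↦ TangentSpace 𝓘(ℝ, E) y) q (Z q)) x →
      TensorialAt 𝓘(ℝ, E) E (Φ · Z) x := by
    intro Z hZ
    constructor
    · intro f σ hf hσ
      have h1 := mvfderiv_fun_mul hf (mdifferentiableAt_inner hσ hZ)
      have h2 := (leviCivita (E := E) (M := M)).isCovariantDerivativeOnUniv.leibniz hσ hf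
      simp only [Φ, Pi.smul_apply', real_inner_smul_left, h1, h2, add_apply, smul_apply,
        ContinuousLinearMap.smulRight_apply, inner_add_left, smul_eq_mul]
      ring
    · intro σ σ' hσ hσ'
      have h1 := mvfderiv_fun_add (mdifferentiableAt_inner hσ hZ) (mdifferentiableAt_inner hσ' hZ)
      have h2 := (leviCivita (E := E) (M := M)).isCovariantDerivativeOnUniv.add hσ hσ'
      simp only [Φ, Pi.add_apply, h1, h2, add_apply, inner_add_left]
      ring
  have h1 : Φ Y Z = Φ (coordField x (Y x)) Z :=
    (htens Z hZ).pointwise hY (mdifferentiableAt_coordField x _) (coordField_self x _).symm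
  have h2 : Φ (coordField x (Y x)) Z = Φ (coordField x (Y x)) (coordField x (Z x)) := by
    rw [hsymm, hsymm (coordField x (Y x))]
    exact (htens _ (mdifferentiableAt_coordField x _)).pointwise hZ
      (mdifferentiableAt_coordField x _) (coordField_self x _).symm
  have h3 : Φ (coordField x (Y x)) (coordField x (Z x)) = 0 := by
    have h4 : mvfderiv 𝓘(ℝ, E) (fun q : M ↦ inner ℝ (coordField x (Y x) q)
      (coordField x (Z x) q)) x u = metricDeriv x u (Y x) (Z x) := rfl
    simp only [Φ, h4, leviCivita_apply, coordDeriv_coordField, coordField_self]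
    simp only [zero_apply, zero_add]
    rw [real_inner_comm (christoffel x u (Z x)), inner_christoffel, inner_christoffel,
      metricDeriv_comm x u (Z x) (Y x), metricDeriv_comm x (Z x) u (Y x),
      metricDeriv_comm x (Y x) u (Z x)]
    ring
  have h5 : Φ Y Z = 0 := by rw [h1, h2, h3]
  simp only [Φ] at h5
  linarith

/-- `leviCivita` is torsion-free. -/
theorem torsion_leviCivita : (leviCivita (E := E) (M := M)).torsion = 0 := by
  ext x v w
  have h : ∀ v w : TangentSpace 𝓘(ℝ, E) x,
      VectorField.mlieBracket 𝓘(ℝ, E) (coordField x v) (coordField x w) x = 0 := by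
    intro v w
    have h2 : ∀ v : TangentSpace 𝓘(ℝ, E) x,
        (VectorField.mpullbackWithin 𝓘(ℝ, E) 𝓘(ℝ, E) (extChartAt 𝓘(ℝ, E) x).symm
          (coordField x v) (range 𝓘(ℝ, E))) =ᶠ[𝓝 (extChartAt 𝓘(ℝ, E) x x)] fun _ ↦ v := by
      intro v
      filter_upwards [extChartAt_target_mem_nhds (I := 𝓘(ℝ, E)) x] with y hy
      have hq : (extChartAt 𝓘(ℝ, E) x).symm y ∈ (chartAt E x).source := by
        simpa using (extChartAt 𝓘(ℝ, E) x).map_target hy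
      have hinv := isInvertible_mfderivWithin_extChartAt_symm (I := 𝓘(ℝ, E)) hy
      have h3 := TangentBundle.symmL_trivializationAt (I := 𝓘(ℝ, E)) hq
      rw [(extChartAt 𝓘(ℝ, E) x).right_inv hy] at h3
      simp only [VectorField.mpullbackWithin_apply, coordField]
      rw [h3]
      exact hinv.inverse_apply_eq.2 rfl
    have h4 : ∀ (A B : E → E) (S : Set E) (a b p : E), S = univ →
        A =ᶠ[𝓝 p] (fun _ ↦ a) → B =ᶠ[𝓝 p] (fun _ ↦ b) →
        VectorField.lieBracketWithin ℝ A B S p = 0 := by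
      intro A B S a b p hS hA hB
      rw [hS, VectorField.lieBracketWithin_univ, hA.lieBracket_vectorField_eq hB]
      simp [VectorField.lieBracket]
    simp only [VectorField.mlieBracket, VectorField.mlieBracketWithin_apply]
    exact (congrArg _ (h4 _ _ _ v w _ (by simp) (h2 v) (h2 w))).trans (map_zero _)
  have h1 := leviCivita.torsion_apply (mdifferentiableAt_coordField x v)
    (mdifferentiableAt_coordField x w)
  rw [coordField_self, coordField_self, h, leviCivita_apply, leviCivita_apply,
    coordDeriv_coordField, coordDeriv_coordField, coordField_self, coordField_self,
    christoffel_symm x w v] at h1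
  rw [h1]
  simp

/-- The Riemannian gradient: `⟨grad f x, v⟩ = Df(x)[v]` for all `v`. -/
def grad (f : M → ℝ) (x : M) : TangentSpace 𝓘(ℝ, E) x :=
  (InnerProductSpace.toDual ℝ (TangentSpace 𝓘(ℝ, E) x)).symm (mvfderiv 𝓘(ℝ, E) f x)

/-- The Riemannian Hessian: `hess f x [v] = ∇_v (grad f) (x)`. -/
def hess (f : M → ℝ) (x : M) : TangentSpace 𝓘(ℝ, E) x →L[ℝ] TangentSpace 𝓘(ℝ, E) x :=
  leviCivita (grad f) x

/-- `f` is twice differentiable: it is differentiable, and its gradient is a differentiable vector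
field. -/
def TwiceDifferentiable (f : M → ℝ) : Prop :=
  MDifferentiable 𝓘(ℝ, E) 𝓘(ℝ) f ∧
    MDifferentiable 𝓘(ℝ, E) 𝓘(ℝ, E).tangent
      (fun x ↦ (⟨x, grad f x⟩ : TangentBundle 𝓘(ℝ, E) M))

/-- The velocity at time `t` of the curve `c`, considered on the time set `J` (one-sided at
the endpoints if `J` is a closed interval). -/
def velocity (c : ℝ → M) (J : Set ℝ) (t : ℝ) : TangentSpace 𝓘(ℝ, E) (c t) :=
  mfderivWithin 𝓘(ℝ) 𝓘(ℝ, E) c J t (1 : ℝ)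

/-- The covariant derivative `DZ/dt` at time `t ∈ J` of a vector field `Z` along a curve `c`, where
`Z` is given as a curve in the tangent bundle and `c t` is the base point of `Z t`.
In the chart at `c t` it is `Z' + Γ(c', Z)`. -/
def covDerivAlong (Z : ℝ → TangentBundle 𝓘(ℝ, E) M) (J : Set ℝ) (t : ℝ) :
    TangentSpace 𝓘(ℝ, E) (Z t).proj :=
  let dZ : TangentSpace 𝓘(ℝ, E) (Z t).proj :=
    (derivWithin (fun τ ↦ coord (Z t).proj (Z τ)) J t : E)
  dZ + christoffel (Z t).proj (velocity (fun τ ↦ (Z τ).proj) J t) (Z t).snd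

/-- `Z`, a curve in the tangent bundle, is a parallel vector field (along its base curve) on the
time interval `J`. -/
def IsParallelOn (Z : ℝ → TangentBundle 𝓘(ℝ, E) M) (J : Set ℝ) : Prop :=
  MDifferentiableOn 𝓘(ℝ) 𝓘(ℝ, E).tangent Z J ∧ ∀ t ∈ J, covDerivAlong Z J t = 0

/-- `γ` is a geodesic on the time interval `J`: a smooth curve whose velocity field has zero
covariant derivative (zero intrinsic acceleration). -/
def IsGeodesicOn (γ : ℝ → M) (J : Set ℝ) : Prop :=
  ContMDiffOn 𝓘(ℝ) 𝓘(ℝ, E) ∞ γ J ∧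
    ∀ t ∈ J, covDerivAlong (fun τ ↦ (⟨γ τ, velocity γ J τ⟩ : TangentBundle 𝓘(ℝ, E) M)) J t = 0

/-- `γ`, on `[0, 1]`, is a geodesic starting at `x` with initial velocity `s`. -/
def IsGeodesicFrom (x : M) (s : TangentSpace 𝓘(ℝ, E) x) (γ : ℝ → M) : Prop :=
  IsGeodesicOn (E := E) γ (Icc 0 1) ∧
    (⟨γ 0, velocity γ (Icc 0 1) 0⟩ : TangentBundle 𝓘(ℝ, E) M) = ⟨x, s⟩

/-- The domain of the exponential map at `x`: the vectors `s` such that the geodesic starting at `x`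
with initial velocity `s` exists until time `1`. -/
def expDomain (x : M) : Set (TangentSpace 𝓘(ℝ, E) x) :=
  {s | ∃ γ : ℝ → M, IsGeodesicFrom x s γ}

open Classical in
/-- The exponential map: `expMap x s = γ 1`, where `γ` is the geodesic starting at `x` with initial
velocity `s` (with the junk value `x` outside of `expDomain x`). -/
def expMap (x : M) (s : TangentSpace 𝓘(ℝ, E) x) : M :=
  if h : ∃ γ : ℝ → M, IsGeodesicFrom x s γ then h.choose 1 else x

/-- `P : T_x M → T_y M` is the parallel transport from `x` to `y` along the curve `c` on `[0, 1]`
(where `c 0 = x` and `c 1 = y`): for each `v` there is a parallel vector field along `c` with value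
`v` at time `0` and value `P v` at time `1`. -/
def IsParallelTransport (c : ℝ → M) (x y : M)
    (P : TangentSpace 𝓘(ℝ, E) x →L[ℝ] TangentSpace 𝓘(ℝ, E) y) : Prop :=
  ∀ v, ∃ Z : ℝ → TangentBundle 𝓘(ℝ, E) M, IsParallelOn Z (Icc 0 1) ∧
    (∀ t ∈ Icc (0 : ℝ) 1, (Z t).proj = c t) ∧ Z 0 = ⟨x, v⟩ ∧ Z 1 = ⟨y, P v⟩

open Classical in
/-- The parallel transport from `x` to `y` along the curve `c` on `[0, 1]` (with the junk value `0`
if there is no such map, for instance if `c 0 ≠ x`). -/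
def parallelTransport (c : ℝ → M) (x y : M) :
    TangentSpace 𝓘(ℝ, E) x →L[ℝ] TangentSpace 𝓘(ℝ, E) y :=
  if h : ∃ P, IsParallelTransport c x y P then h.choose else 0

/-- The parallel transport `P_s : T_x M → T_{exp_x(s)} M` along the geodesic `t ↦ exp_x(t s)`, from
`t = 0` to `t = 1`. -/
def expTransport (x : M) (s : TangentSpace 𝓘(ℝ, E) x) :
    TangentSpace 𝓘(ℝ, E) x →L[ℝ] TangentSpace 𝓘(ℝ, E) (expMap x s) :=
  parallelTransport (fun t : ℝ ↦ expMap x (t • s)) x (expMap x s)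

/-- The inverse `P_s⁻¹ : T_{exp_x(s)} M → T_x M` of `expTransport`. -/
def expTransportInv (x : M) (s : TangentSpace 𝓘(ℝ, E) x) :
    TangentSpace 𝓘(ℝ, E) (expMap x s) →L[ℝ] TangentSpace 𝓘(ℝ, E) x :=
  (expTransport x s).inverse

end Metric

end RiemannianTaylor

end

noncomputable section

namespace RiemannianTaylor

set_option linter.unusedSectionVars false
set_option maxSynthPendingDepth 3

/-! Let `γ t = Exp_x(ts)` and let `T t` be parallel transport along `γ` from time `0` to `t`. The
velocity of a geodesic is parallel, so `γ' t = T t s`. For a fixed `v` in `T_x M`, metric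
compatibility makes the derivative of `⟨grad f (γ t), T t v⟩` equal to `⟨Hess f (γ t) [T t s], T t
v⟩`, that is, to `⟨(T t)⁻¹ Hess f (γ t) (T t) s, v⟩` because `T t` is an isometry. By hypothesis
this is within `L t ‖s‖² ‖v‖` of the constant `⟨Hess f x [s], v⟩`. One integration bounds the error
of the pulled-back gradient, tested against `v`, by `(L/2) t² ‖s‖² ‖v‖`. Testing against the error
vector itself gives the gradient bound. Testing against `s`, where `⟨grad f (γ t), T t s⟩ = (f ∘ γ)'
t`, and integrating once more gives the constant `L/6`. The derivative of the gradient need not be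
integrable, so "integration" is the mean value inequality `abs_le_of_abs_deriv_le_pow`. This
argument is `taylor_along_geodesic`.

The remaining work identifies the chosen objects `expMap` and `parallelTransport` with `γ` and `T`.
Covariant derivatives are defined in the chart centred at the moving point, whereas differential
equations need one fixed chart. The Koszul formula `leviCivita_frame` and the transformation law
`hasCovDerivWithinAt_of_chart` pass from one to the other. Uniqueness of geodesics
(`IsGeodesicFrom.eqOn`) and rescaling of time then give `expMap_smul_eq`. Parallel fields exist by
solving a linear equation on short intervals and gluing; they are unique because inner products of
parallel fields are constant, which yields `parallelTransport_eq`. -/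

theorem _root_.HasFDerivAt.hasDerivWithinAt_clm_comp_apply {E F G : Type*} [NormedAddCommGroup E]
    [NormedSpace ℝ E] [NormedAddCommGroup F] [NormedSpace ℝ F] [NormedAddCommGroup G]
    [NormedSpace ℝ G] {A : E → F →L[ℝ] G} {A' : E →L[ℝ] F →L[ℝ] G} {y : ℝ → E} {z : ℝ → F}
    {S : Set ℝ} {t : ℝ} {y' : E} {z' : F} (hA : HasFDerivAt A A' (y t))
    (hy : HasDerivWithinAt y y' S t) (hz : HasDerivWithinAt z z' S t) :
    HasDerivWithinAt (fun τ ↦ A (y τ) (z τ)) (A' y' (z t) + A (y t) z') S t :=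
  (hA.comp_hasDerivWithinAt t hy).clm_apply hz

/-! ### Coordinate frames and changes of chart -/

section Frames

variable {E : Type*} [NormedAddCommGroup E] [NormedSpace ℝ E]
  {M : Type*} [TopologicalSpace M] [ChartedSpace E M] [IsManifold 𝓘(ℝ, E) ∞ M]

/-- The linear map sending `v : E` to the tangent vector at `q` with coordinates `v` in the chart
at `p`. -/
def frame (p q : M) : E →L[ℝ] TangentSpace 𝓘(ℝ, E) q :=
  (trivializationAt E (TangentSpace 𝓘(ℝ, E) (M := M)) p).symmL ℝ q

/-- The coordinates, in the chart at `p`, of the tangent vectors at `q`. -/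
def coframe (p q : M) : TangentSpace 𝓘(ℝ, E) q →L[ℝ] E :=
  (trivializationAt E (TangentSpace 𝓘(ℝ, E) (M := M)) p).continuousLinearMapAt ℝ q

theorem coordField_eq_frame (p : M) (v : E) :
    coordField (E := E) p v = fun q ↦ frame p q v := rfl

theorem coord_eq_coframe {p q : M} (hq : q ∈ (chartAt E p).source) (w : TangentSpace 𝓘(ℝ, E) q) :
    coord p ⟨q, w⟩ = coframe p q w :=
  (Trivialization.continuousLinearMapAt_apply_of_mem (R := ℝ) _ hq w).symm

theorem coframe_frame {p q : M} (hq : q ∈ (chartAt E p).source) (v : E) :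
    coframe p q (frame p q v) = v :=
  (trivializationAt E (TangentSpace 𝓘(ℝ, E) (M := M)) p).continuousLinearMapAt_symmL (R := ℝ) hq v

theorem frame_coframe {p q : M} (hq : q ∈ (chartAt E p).source) (w : TangentSpace 𝓘(ℝ, E) q) :
    frame p q (coframe p q w) = w :=
  (trivializationAt E (TangentSpace 𝓘(ℝ, E) (M := M)) p).symmL_continuousLinearMapAt (R := ℝ) hq w

theorem coord_frame {p q : M} (hq : q ∈ (chartAt E p).source) (v : E) :
    coord p ⟨q, frame p q v⟩ = v := by
  rw [coord_eq_coframe hq, coframe_frame hq]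

theorem frame_coord {p q : M} (hq : q ∈ (chartAt E p).source) (w : TangentSpace 𝓘(ℝ, E) q) :
    frame p q (coord p ⟨q, w⟩) = w := by
  rw [coord_eq_coframe hq, frame_coframe hq]

theorem frame_self (p : M) (v : E) : frame p p v = v := coordField_self p v

theorem coframe_self (p : M) (v : E) : coframe p p v = v := by
  have h := coframe_frame (mem_chart_source E p) v
  rwa [frame_self] at h

/-- The transition map from the chart at `p` to the chart at `q`. -/
def transition (p q : M) : E → E := extChartAt 𝓘(ℝ, E) q ∘ (extChartAt 𝓘(ℝ, E) p).symm

theorem contDiffAt_transition {p q r : M} (hp : r ∈ (chartAt E p).source)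
    (hq : r ∈ (chartAt E q).source) :
    ContDiffAt ℝ ∞ (transition p q) (extChartAt 𝓘(ℝ, E) p r) := by
  have h := contDiffWithinAt_ext_coord_change (I := 𝓘(ℝ, E)) (n := ∞) q p
    (y := extChartAt 𝓘(ℝ, E) p r) (by simp [hp, hq])
  rwa [modelWithCornersSelf_coe, range_id, contDiffWithinAt_univ] at h

/-- The tangent bundle is glued by derivatives of chart transitions; this turns every change of
tangent coordinates into calculus in `E`. -/
theorem coord_frame_eq_fderiv {p q r : M} (hp : r ∈ (chartAt E p).source)
    (hq : r ∈ (chartAt E q).source) (v : E) :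
    coord q ⟨r, frame p r v⟩ = fderiv ℝ (transition p q) (extChartAt 𝓘(ℝ, E) p r) v := by
  have h := tangentCoordChange_comp (I := 𝓘(ℝ, E)) (w := p) (x := r) (y := q) (z := r) (v := v)
    (by simp [hp, hq])
  rw [coord_eq_coframe hq, coframe, frame,
    TangentBundle.continuousLinearMapAt_trivializationAt_eq_core hq,
    TangentBundle.symmL_trivializationAt_eq_core hp]
  refine h.trans ?_
  rw [tangentCoordChange_def, modelWithCornersSelf_coe, range_id, fderivWithin_univ]
  rfl

theorem mfderiv_extChartAt {p q : M} (hq : q ∈ (chartAt E p).source)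
    (w : TangentSpace 𝓘(ℝ, E) q) :
    mfderiv 𝓘(ℝ, E) 𝓘(ℝ, E) (extChartAt 𝓘(ℝ, E) p) q w = coframe p q w := by
  rw [← TangentBundle.continuousLinearMapAt_trivializationAt hq]
  rfl

theorem eventually_mem_chart_source_inter {p q : M} (hq : q ∈ (chartAt E p).source) :
    ∀ᶠ r in 𝓝 q, r ∈ (chartAt E p).source ∧ r ∈ (chartAt E q).source :=
  Filter.Eventually.and ((chartAt E p).open_source.mem_nhds hq)
    ((chartAt E q).open_source.mem_nhds (mem_chart_source E q))

/-- A frame with constant coordinates at `p` has coordinates at `q` given by the first derivative of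
the transition, so differentiating leaves the second derivative: the inhomogeneous term in the
transformation law of Christoffel symbols. -/
theorem mvfderiv_coord_frame {p q : M} (hq : q ∈ (chartAt E p).source) (v : E)
    (w : TangentSpace 𝓘(ℝ, E) q) :
    mvfderiv 𝓘(ℝ, E) (fun r : M ↦ coord q ⟨r, frame p r v⟩) q w =
      fderiv ℝ (fderiv ℝ (transition p q)) (extChartAt 𝓘(ℝ, E) p q) (coframe p q w) v := by
  have h1 : (fun r : M ↦ coord q ⟨r, frame p r v⟩) =ᶠ[𝓝 q]
      (fun y ↦ fderiv ℝ (transition p q) y v) ∘ extChartAt 𝓘(ℝ, E) p := by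
    filter_upwards [eventually_mem_chart_source_inter hq] with r hr
    exact coord_frame_eq_fderiv hr.1 hr.2 v
  have h2 : DifferentiableAt ℝ (fderiv ℝ (transition p q)) (extChartAt 𝓘(ℝ, E) p q) :=
    ((contDiffAt_transition hq (mem_chart_source E q)).fderiv_right (m := 1)
      (by norm_cast)).differentiableAt (by simp)
  have h3 : HasFDerivAt (fun y ↦ fderiv ℝ (transition p q) y v) _ (extChartAt 𝓘(ℝ, E) p q) :=
    h2.hasFDerivAt.clm_apply (hasFDerivAt_const v _)
  have h4 : HasMFDerivAt 𝓘(ℝ, E) 𝓘(ℝ, E) (extChartAt 𝓘(ℝ, E) p) q _ :=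
    (mdifferentiableAt_extChartAt hq).hasMFDerivAt
  rw [mvfderiv_congr h1]
  have h5 := (h3.hasMFDerivAt.comp q h4).mfderiv
  have h6 := congrArg (fun A : E →L[ℝ] E ↦ A w) h5
  refine h6.trans ?_
  have h7 := mfderiv_extChartAt hq w
  rw [ContinuousLinearMap.comp_zero, zero_add]
  exact congrArg (fun a ↦ fderiv ℝ (fderiv ℝ (transition p q)) (extChartAt 𝓘(ℝ, E) p q) a v) h7

theorem second_fderiv_transition_comm {p q : M} (hq : q ∈ (chartAt E p).source) (u v : E) :
    fderiv ℝ (fderiv ℝ (transition p q)) (extChartAt 𝓘(ℝ, E) p q) u v =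
      fderiv ℝ (fderiv ℝ (transition p q)) (extChartAt 𝓘(ℝ, E) p q) v u :=
  ((contDiffAt_transition hq (mem_chart_source E q)).isSymmSndFDerivAt
    (by simpa using ENat.LEInfty.out)) u v

/-- As a type, the tangent space at `q` is `E`, identified through the chart at `q` itself, so a
tangent vector at `q` is its own coordinate vector there. -/
theorem frame_eq_fderiv {p q : M} (hq : q ∈ (chartAt E p).source) (v : E) :
    frame p q v = fderiv ℝ (transition p q) (extChartAt 𝓘(ℝ, E) p q) v := by
  rw [← coord_frame_eq_fderiv hq (mem_chart_source E _), coord_self]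

/-- If `y` and `z` are the coordinates of a curve and of a vector field along it in the chart at
`p`, then the derivative of the coordinates of the vector field in the chart at `q` follows from
those of `y` and `z`. -/
theorem hasDerivWithinAt_coord_frame {p q : M} {c : ℝ → M} {z : ℝ → E} {S : Set ℝ} {t : ℝ}
    {y' z' : E} (hp : c t ∈ (chartAt E p).source) (hq : c t ∈ (chartAt E q).source)
    (hc : ContinuousWithinAt c S t)
    (hy : HasDerivWithinAt (fun τ ↦ extChartAt 𝓘(ℝ, E) p (c τ)) y' S t)
    (hz : HasDerivWithinAt z z' S t) :
    HasDerivWithinAt (fun τ ↦ coord q ⟨c τ, frame p (c τ) (z τ)⟩)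
      (fderiv ℝ (fderiv ℝ (transition p q)) (extChartAt 𝓘(ℝ, E) p (c t)) y' (z t) +
        fderiv ℝ (transition p q) (extChartAt 𝓘(ℝ, E) p (c t)) z') S t := by
  have h2 : DifferentiableAt ℝ (fderiv ℝ (transition p q)) (extChartAt 𝓘(ℝ, E) p (c t)) :=
    ((contDiffAt_transition hp hq).fderiv_right (m := 1) (by norm_cast)).differentiableAt (by simp)
  have h3 := h2.hasFDerivAt.hasDerivWithinAt_clm_comp_apply
    (y := fun τ ↦ extChartAt 𝓘(ℝ, E) p (c τ)) hy hz
  have h4 : (fun τ ↦ coord q ⟨c τ, frame p (c τ) (z τ)⟩) =ᶠ[𝓝[S] t]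
      (fun τ ↦ fderiv ℝ (transition p q) (extChartAt 𝓘(ℝ, E) p (c τ)) (z τ)) := by
    filter_upwards [hc.eventually ((chartAt E p).open_source.mem_nhds hp),
      hc.eventually ((chartAt E q).open_source.mem_nhds hq)] with r hr hr'
    exact coord_frame_eq_fderiv hr hr' _
  exact h3.congr_of_eventuallyEq h4 (coord_frame_eq_fderiv hp hq (z t))

end Frames

/-! ### Christoffel symbols of a metric on a vector space -/

section Koszul

variable {E : Type*} [NormedAddCommGroup E] [NormedSpace ℝ E]

/-- The Christoffel symbols `v ↦ Γ(u, v)` at `y` of a metric `G` on a vector space. -/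
def christoffelOf (G : E → E →L[ℝ] E →L[ℝ] ℝ) (y u : E) : E →L[ℝ] E :=
  (G y).inverse ∘L ((1 / 2 : ℝ) • (fderiv ℝ G y u +
    (fderiv ℝ G y).flip u - ((fderiv ℝ G y).flip u).flip))

theorem apply_christoffelOf {G : E → E →L[ℝ] E →L[ℝ] ℝ} {y : E} (hG : (G y).IsInvertible)
    (u v w : E) :
    G y (christoffelOf G y u v) w =
      (fderiv ℝ G y u v w + fderiv ℝ G y v u w - fderiv ℝ G y w u v) / 2 := by
  obtain ⟨e, he⟩ := hG
  rw [christoffelOf, ContinuousLinearMap.comp_apply, ← he, ContinuousLinearMap.inverse_equiv]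
  simp
  ring

/-- Inversion is smooth at invertible operators, and in finite dimension smoothness of the other
factor may be tested on fixed vectors. This regularity makes the geodesic field locally Lipschitz
and the parallel transport equation continuous. -/
theorem contDiffOn_christoffelOf [FiniteDimensional ℝ E] {G : E → E →L[ℝ] E →L[ℝ] ℝ} {s : Set E}
    (hs : IsOpen s) (hG : ContDiffOn ℝ ∞ G s) (hinv : ∀ y ∈ s, (G y).IsInvertible) :
    ContDiffOn ℝ ∞ (fun a : E × E ↦ christoffelOf G a.1 a.2) (s ×ˢ univ) := by
  have hfst : ContDiffOn ℝ ∞ (Prod.fst : E × E → E) (s ×ˢ univ) := contDiff_fst.contDiffOn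
  have hsnd : ContDiffOn ℝ ∞ (Prod.snd : E × E → E) (s ×ˢ univ) := contDiff_snd.contDiffOn
  have hD : ContDiffOn ℝ ∞ (fun a : E × E ↦ fderiv ℝ G a.1) (s ×ˢ univ) :=
    (hG.fderiv_of_isOpen hs (m := ∞) (by simp)).comp hfst fun a ha ↦ ha.1
  have hI : ContDiffOn ℝ ∞ (fun a : E × E ↦ (G a.1).inverse) (s ×ˢ univ) := by
    intro a ha
    obtain ⟨e, he⟩ := hinv a.1 ha.1
    have : CompleteSpace E := FiniteDimensional.complete ℝ E
    have h1 := contDiffAt_map_inverse (𝕜 := ℝ) (n := ∞) e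
    rw [he] at h1
    exact h1.comp_contDiffWithinAt a ((hG.comp hfst fun a ha ↦ ha.1) a ha)
  refine hI.clm_comp (ContDiffOn.const_smul (1 / 2 : ℝ) ?_)
  refine contDiffOn_clm_apply.2 fun v ↦ contDiffOn_clm_apply.2 fun w ↦ ?_
  have h1 : ContDiffOn ℝ ∞ (fun a : E × E ↦ fderiv ℝ G a.1 a.2 v w) (s ×ˢ univ) :=
    ((hD.clm_apply hsnd).clm_apply contDiffOn_const).clm_apply contDiffOn_const
  have h2 : ContDiffOn ℝ ∞ (fun a : E × E ↦ fderiv ℝ G a.1 v a.2 w) (s ×ˢ univ) :=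
    ((hD.clm_apply contDiffOn_const).clm_apply hsnd).clm_apply contDiffOn_const
  have h3 : ContDiffOn ℝ ∞ (fun a : E × E ↦ fderiv ℝ G a.1 w a.2 v) (s ×ˢ univ) :=
    ((hD.clm_apply contDiffOn_const).clm_apply hsnd).clm_apply contDiffOn_const
  exact (h1.add h2).sub h3

theorem _root_.HasFDerivAt.hasFDerivAt_apply_apply {G : E → E →L[ℝ] E →L[ℝ] ℝ}
    {G' : E →L[ℝ] E →L[ℝ] E →L[ℝ] ℝ} {y : E} (h : HasFDerivAt G G' y) (v w : E) :
    HasFDerivAt (fun y ↦ G y v w) ((G'.flip v).flip w) y := by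
  have h1 := (h.clm_apply (hasFDerivAt_const v y)).clm_apply (hasFDerivAt_const w y)
  have h2 : (G'.flip v).flip w = G y v ∘L (0 : E →L[ℝ] E) + (G y ∘L (0 : E →L[ℝ] E) + G'.flip v).flip w := by
    ext u
    simp
  rw [h2]
  exact h1

end Koszul

/-! ### Smoothness of coordinate frames -/

section FrameSmooth

variable {E : Type*} [NormedAddCommGroup E] [NormedSpace ℝ E]
  {M : Type*} [TopologicalSpace M] [ChartedSpace E M] [IsManifold 𝓘(ℝ, E) ∞ M]

theorem contMDiffOn_frame (p : M) (v : E) :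
    ContMDiffOn 𝓘(ℝ, E) (𝓘(ℝ, E).prod 𝓘(ℝ, E)) ∞
      (fun q ↦ TotalSpace.mk' E (E := fun y : M ↦ TangentSpace 𝓘(ℝ, E) y) q (frame p q v))
      (chartAt E p).source := by
  have h := (trivializationAt E (TangentSpace 𝓘(ℝ, E) (M := M)) p).contMDiffOn_section_baseSet_iff
    (IB := 𝓘(ℝ, E)) (n := ∞) (s := fun q ↦ frame p q v)
  refine h.2 ?_
  exact contMDiffOn_const.congr fun q hq ↦ coord_frame hq v

theorem mdifferentiableAt_frame {p q : M} (hq : q ∈ (chartAt E p).source) (v : E) :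
    MDifferentiableAt 𝓘(ℝ, E) (𝓘(ℝ, E).prod 𝓘(ℝ, E))
      (fun q ↦ TotalSpace.mk' E (E := fun y : M ↦ TangentSpace 𝓘(ℝ, E) y) q (frame p q v)) q :=
  ((contMDiffOn_frame p v).contMDiffAt ((chartAt E p).open_source.mem_nhds hq)).mdifferentiableAt
    (by simp)

end FrameSmooth

/-! ### The Levi-Civita connection in a fixed chart -/

section Christoffel

variable {E : Type*} [NormedAddCommGroup E] [NormedSpace ℝ E] [FiniteDimensional ℝ E]
  {M : Type*} [TopologicalSpace M] [ChartedSpace E M] [IsManifold 𝓘(ℝ, E) ∞ M]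
  [RiemannianBundle (fun x : M ↦ TangentSpace 𝓘(ℝ, E) x)]

/-- The matrix of the metric in the chart at `p`, at the point with coordinates `y`. -/
def metricCoeff (p : M) (y : E) : E →L[ℝ] E →L[ℝ] ℝ :=
  LinearMap.toContinuousLinearMap (LinearMap.toContinuousLinearMap.toLinearMap ∘ₗ
    LinearMap.mk₂ ℝ
      (fun u v ↦ inner ℝ (frame p ((extChartAt 𝓘(ℝ, E) p).symm y) u)
        (frame p ((extChartAt 𝓘(ℝ, E) p).symm y) v))
      (fun _ _ _ ↦ by rw [map_add, inner_add_left])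
      (fun _ _ _ ↦ by rw [map_smul, real_inner_smul_left, smul_eq_mul])
      (fun _ _ _ ↦ by rw [map_add, inner_add_right])
      (fun _ _ _ ↦ by rw [map_smul, real_inner_smul_right, smul_eq_mul]))

theorem metricCoeff_apply (p : M) (y u v : E) :
    metricCoeff p y u v = inner ℝ (frame p ((extChartAt 𝓘(ℝ, E) p).symm y) u)
      (frame p ((extChartAt 𝓘(ℝ, E) p).symm y) v) := rfl

theorem metricCoeff_extChartAt {p q : M} (hq : q ∈ (chartAt E p).source) (u v : E) :
    metricCoeff p (extChartAt 𝓘(ℝ, E) p q) u v = inner ℝ (frame p q u) (frame p q v) := by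
  rw [metricCoeff_apply, (extChartAt 𝓘(ℝ, E) p).left_inv (by simpa using hq)]

/-- Positive definiteness gives injectivity, and `E` and its dual have the same dimension. -/
theorem isInvertible_metricCoeff {p : M} {y : E} (hy : y ∈ (extChartAt 𝓘(ℝ, E) p).target) :
    (metricCoeff p y).IsInvertible := by
  have hq : (extChartAt 𝓘(ℝ, E) p).symm y ∈ (chartAt E p).source := by
    simpa using (extChartAt 𝓘(ℝ, E) p).map_target hy
  have hinj : Function.Injective (metricCoeff p y) := by
    rw [injective_iff_map_eq_zero]
    intro u hu
    have h1 : metricCoeff p y u u = 0 := by rw [hu]; rfl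
    rw [metricCoeff_apply, inner_self_eq_zero] at h1
    rw [← coframe_frame hq u, h1, map_zero]
  have hdim : Module.finrank ℝ E = Module.finrank ℝ (E →L[ℝ] ℝ) := by
    rw [← (LinearMap.toContinuousLinearMap (𝕜 := ℝ) (E := E) (F' := ℝ)).finrank_eq]
    exact (Subspace.dual_finrank_eq (K := ℝ) (V := E)).symm
  refine ⟨(LinearEquiv.ofInjectiveOfFinrankEq
    (metricCoeff p y : E →ₗ[ℝ] E →L[ℝ] ℝ) hinj hdim).toContinuousLinearEquiv, ?_⟩
  ext u v
  rfl

/-- The Christoffel symbols `v ↦ Γ(u, v)` in the chart at `p`, at the point with coordinates `y`. -/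
def chartChristoffel (p : M) (y u : E) : E →L[ℝ] E :=
  christoffelOf (metricCoeff p) y u

theorem metricCoeff_chartChristoffel {p : M} {y : E} (hy : y ∈ (extChartAt 𝓘(ℝ, E) p).target)
    (u v w : E) :
    metricCoeff p y (chartChristoffel p y u v) w =
      (fderiv ℝ (metricCoeff p) y u v w + fderiv ℝ (metricCoeff p) y v u w -
        fderiv ℝ (metricCoeff p) y w u v) / 2 :=
  apply_christoffelOf (isInvertible_metricCoeff hy) u v w

variable [IsContMDiffRiemannianBundle 𝓘(ℝ, E) ∞ E (fun x : M ↦ TangentSpace 𝓘(ℝ, E) x)]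

theorem contMDiffOn_inner_frame (p : M) (u v : E) :
    ContMDiffOn 𝓘(ℝ, E) 𝓘(ℝ) ∞ (fun q : M ↦ inner ℝ (frame p q u) (frame p q v))
      (chartAt E p).source :=
  ContMDiffOn.inner_bundle (contMDiffOn_frame p u) (contMDiffOn_frame p v)

theorem contDiffOn_metricCoeff (p : M) :
    ContDiffOn ℝ ∞ (metricCoeff (E := E) p) (extChartAt 𝓘(ℝ, E) p).target := by
  refine contDiffOn_clm_apply.2 fun u ↦ contDiffOn_clm_apply.2 fun v ↦ ?_
  have h := (contMDiffOn_inner_frame p u v).comp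
    (contMDiffOn_extChartAt_symm (I := 𝓘(ℝ, E)) (n := ∞) p) (fun y hy ↦ by
    simpa using (extChartAt 𝓘(ℝ, E) p).map_target hy)
  exact contMDiffOn_iff_contDiffOn.1 h

theorem contDiffOn_chartChristoffel (p : M) :
    ContDiffOn ℝ ∞ (fun a : E × E ↦ chartChristoffel p a.1 a.2)
      ((extChartAt 𝓘(ℝ, E) p).target ×ˢ univ) :=
  contDiffOn_christoffelOf (isOpen_extChartAt_target (I := 𝓘(ℝ, E)) p)
    (contDiffOn_metricCoeff p) fun _ hy ↦ isInvertible_metricCoeff hy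

/-- The covariant derivative of the coordinate fields in the chart at `p`. -/
theorem leviCivita_frame_eq {p q : M} (hq : q ∈ (chartAt E p).source) (u v : E) :
    leviCivita (fun r : M ↦ frame p r v) q (frame p q u) =
      (show TangentSpace 𝓘(ℝ, E) q from
        fderiv ℝ (fderiv ℝ (transition p q)) (extChartAt 𝓘(ℝ, E) p q) u v) +
      christoffel q (frame p q u) (frame p q v) := by
  have h := mvfderiv_coord_frame hq v (frame p q u)
  rw [coframe_frame hq] at h
  rw [leviCivita_apply, ← h]
  rfl

/-- Torsion-freeness for coordinate fields: both the second derivative of the transition and the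
Christoffel symbol are symmetric. -/
theorem leviCivita_frame_symm {p q : M} (hq : q ∈ (chartAt E p).source) (u v : E) :
    leviCivita (fun r : M ↦ frame p r v) q (frame p q u) =
      leviCivita (fun r : M ↦ frame p r u) q (frame p q v) := by
  rw [leviCivita_frame_eq hq, leviCivita_frame_eq hq, christoffel_symm,
    second_fderiv_transition_comm hq]

/-- Metric compatibility `leviCivita_inner`, transported to the chart by the chain rule. With the
symmetry above it supplies both inputs of the Koszul formula. -/
theorem fderiv_metricCoeff {p q : M} (hq : q ∈ (chartAt E p).source) (u v w : E) :
    fderiv ℝ (metricCoeff p) (extChartAt 𝓘(ℝ, E) p q) u v w =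
      inner ℝ (leviCivita (fun r : M ↦ frame p r v) q (frame p q u)) (frame p q w) +
      inner ℝ (frame p q v) (leviCivita (fun r : M ↦ frame p r w) q (frame p q u)) := by
  have h0 : extChartAt 𝓘(ℝ, E) p q ∈ (extChartAt 𝓘(ℝ, E) p).target :=
    (extChartAt 𝓘(ℝ, E) p).map_source (by simpa using hq)
  have h1 : (fun r : M ↦ inner ℝ (frame p r v) (frame p r w)) =ᶠ[𝓝 q]
      (fun y ↦ metricCoeff p y v w) ∘ extChartAt 𝓘(ℝ, E) p := by
    filter_upwards [(chartAt E p).open_source.mem_nhds hq] with r hr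
    exact (metricCoeff_extChartAt hr v w).symm
  have h2 := (((contDiffOn_metricCoeff p).contDiffAt
    ((isOpen_extChartAt_target p).mem_nhds h0)).differentiableAt (by simp)).hasFDerivAt
  have h3 := (h2.hasFDerivAt_apply_apply v w).hasMFDerivAt.comp q
    (mdifferentiableAt_extChartAt hq).hasMFDerivAt
  have h4 := congrArg (fun A : E →L[ℝ] ℝ ↦ A (frame p q u)) h3.mfderiv
  have h5 := (mfderiv_extChartAt hq (frame p q u)).trans (coframe_frame hq u)
  rw [← leviCivita_inner (mdifferentiableAt_frame hq v) (mdifferentiableAt_frame hq w),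
    mvfderiv_congr h1]
  refine Eq.trans ?_ h4.symm
  exact congrArg (fun a ↦ fderiv ℝ (metricCoeff p) (extChartAt 𝓘(ℝ, E) p q) a v w) h5.symm

/-- The Koszul formula for coordinate fields. -/
theorem leviCivita_frame {p q : M} (hq : q ∈ (chartAt E p).source) (u v : E) :
    leviCivita (fun r : M ↦ frame p r v) q (frame p q u) =
      frame p q (chartChristoffel p (extChartAt 𝓘(ℝ, E) p q) u v) := by
  have hy : extChartAt 𝓘(ℝ, E) p q ∈ (extChartAt 𝓘(ℝ, E) p).target :=
    (extChartAt 𝓘(ℝ, E) p).map_source (by simpa using hq)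
  -- Both sides are tested against frame vectors; in the Koszul combination of metric derivatives,
  -- symmetry cancels all but twice the wanted term.
  refine ext_inner_right ℝ fun b ↦ ?_
  obtain ⟨w, rfl⟩ : ∃ w, b = frame p q w := ⟨_, (frame_coframe hq b).symm⟩
  rw [← metricCoeff_extChartAt hq, metricCoeff_chartChristoffel hy, fderiv_metricCoeff hq,
    fderiv_metricCoeff hq, fderiv_metricCoeff hq, leviCivita_frame_symm hq v u,
    leviCivita_frame_symm hq w u, leviCivita_frame_symm hq w v,
    real_inner_comm _ (frame p q v), real_inner_comm _ (frame p q u)]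
  ring

end Christoffel

/-! ### Velocities of curves -/

section Velocity

variable {E : Type*} [NormedAddCommGroup E] [NormedSpace ℝ E]
  {M : Type*} [TopologicalSpace M] [ChartedSpace E M] [IsManifold 𝓘(ℝ, E) ∞ M]

/-- The curve `c` has velocity `u` at time `t`, within the time set `S`. -/
def HasVelocityWithinAt (c : ℝ → M) (S : Set ℝ) (t : ℝ) (u : TangentSpace 𝓘(ℝ, E) (c t)) : Prop :=
  HasMFDerivWithinAt 𝓘(ℝ) 𝓘(ℝ, E) c S t ((1 : ℝ →L[ℝ] ℝ).smulRight (M₂ := E) u)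

theorem HasVelocityWithinAt.continuousWithinAt {c : ℝ → M} {S : Set ℝ} {t : ℝ}
    {u : TangentSpace 𝓘(ℝ, E) (c t)} (h : HasVelocityWithinAt c S t u) :
    ContinuousWithinAt c S t :=
  HasMFDerivWithinAt.continuousWithinAt h

theorem HasVelocityWithinAt.mono {c : ℝ → M} {S S' : Set ℝ} {t : ℝ}
    {u : TangentSpace 𝓘(ℝ, E) (c t)} (h : HasVelocityWithinAt c S t u) (hS : S' ⊆ S) :
    HasVelocityWithinAt c S' t u :=
  HasMFDerivWithinAt.mono h hS

theorem hasVelocityWithinAt_velocity {c : ℝ → M} {S : Set ℝ} {t : ℝ}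
    (h : MDifferentiableWithinAt 𝓘(ℝ) 𝓘(ℝ, E) c S t) :
    HasVelocityWithinAt (E := E) c S t (velocity c S t) := by
  have h1 := h.hasMFDerivWithinAt
  have h2 : ((1 : ℝ →L[ℝ] ℝ).smulRight (M₂ := E) (velocity c S t) : ℝ →L[ℝ] E) =
      mfderivWithin 𝓘(ℝ) 𝓘(ℝ, E) c S t := by
    refine ContinuousLinearMap.ext_ring ?_
    exact one_smul ℝ _
  rw [HasVelocityWithinAt, h2]
  exact h1

theorem HasVelocityWithinAt.velocity_eq {c : ℝ → M} {S : Set ℝ} {t : ℝ}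
    {u : TangentSpace 𝓘(ℝ, E) (c t)} (h : HasVelocityWithinAt c S t u)
    (hS : UniqueDiffWithinAt ℝ S t) : velocity c S t = u := by
  have h1 := HasMFDerivWithinAt.mfderivWithin h hS.uniqueMDiffWithinAt
  exact (congrArg (fun A : ℝ →L[ℝ] E ↦ A 1) h1).trans (one_smul ℝ _)

theorem HasVelocityWithinAt.hasDerivWithinAt_comp {F : Type*} [NormedAddCommGroup F]
    [NormedSpace ℝ F] {g : M → F} {c : ℝ → M} {S : Set ℝ} {t : ℝ}
    {u : TangentSpace 𝓘(ℝ, E) (c t)} (h : HasVelocityWithinAt c S t u)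
    (hg : MDifferentiableAt 𝓘(ℝ, E) 𝓘(ℝ, F) g (c t)) :
    HasDerivWithinAt (fun τ ↦ g (c τ)) (mvfderiv 𝓘(ℝ, E) g (c t) u) S t := by
  have h1 : HasFDerivWithinAt (fun τ ↦ g (c τ)) ((mvfderiv 𝓘(ℝ, E) g (c t) : E →L[ℝ] F) ∘L
      (1 : ℝ →L[ℝ] ℝ).smulRight (M₂ := E) u) S t :=
    (hg.hasMFDerivAt.comp_hasMFDerivWithinAt t h).hasFDerivWithinAt
  have h2 : ((mvfderiv 𝓘(ℝ, E) g (c t) : E →L[ℝ] F) ∘L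
      (1 : ℝ →L[ℝ] ℝ).smulRight (M₂ := E) u) 1 = mvfderiv 𝓘(ℝ, E) g (c t) u :=
    congrArg (mvfderiv 𝓘(ℝ, E) g (c t)) (one_smul ℝ u)
  rw [← h2]
  exact h1.hasDerivWithinAt

theorem HasVelocityWithinAt.hasDerivWithinAt_extChartAt {p : M} {c : ℝ → M} {S : Set ℝ} {t : ℝ}
    {u : TangentSpace 𝓘(ℝ, E) (c t)} (h : HasVelocityWithinAt c S t u)
    (hp : c t ∈ (chartAt E p).source) :
    HasDerivWithinAt (fun τ ↦ extChartAt 𝓘(ℝ, E) p (c τ)) (coframe p (c t) u) S t := by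
  rw [← mfderiv_extChartAt hp]
  exact h.hasDerivWithinAt_comp (mdifferentiableAt_extChartAt hp)

theorem HasVelocityWithinAt.comp_mul_left {c : ℝ → M} {S S' : Set ℝ} {t k : ℝ}
    {u : TangentSpace 𝓘(ℝ, E) (c (k * t))} (h : HasVelocityWithinAt c S (k * t) u)
    (hS : MapsTo (fun τ ↦ k * τ) S' S) :
    HasVelocityWithinAt (fun τ ↦ c (k * τ)) S' t (k • u) := by
  have h1 : HasDerivWithinAt (fun τ : ℝ ↦ k * τ) k S' t := by
    simpa using (hasDerivWithinAt_id t S').const_mul k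
  have h2 := HasMFDerivWithinAt.comp t h h1.hasFDerivWithinAt.hasMFDerivWithinAt hS
  have h3 : ∀ v : E, (1 : ℝ →L[ℝ] ℝ).smulRight (k • v) =
      (1 : ℝ →L[ℝ] ℝ).smulRight v ∘L ContinuousLinearMap.toSpanSingleton ℝ k := fun v ↦
    ContinuousLinearMap.ext_ring (by simp)
  have h4 := h3 u
  unfold HasVelocityWithinAt
  exact h4 ▸ h2

end Velocity

/-! ### Covariant derivatives along curves -/

section CovDeriv

variable {E : Type*} [NormedAddCommGroup E] [NormedSpace ℝ E] [FiniteDimensional ℝ E]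
  {M : Type*} [TopologicalSpace M] [ChartedSpace E M] [IsManifold 𝓘(ℝ, E) ∞ M]
  [RiemannianBundle (fun x : M ↦ TangentSpace 𝓘(ℝ, E) x)]

/-- The vector field `V` along the curve `c`, which has velocity `u` at time `t`, has covariant
derivative `w` at time `t` within the time set `S`. -/
def HasCovDerivWithinAt (c : ℝ → M) (V : ∀ τ, TangentSpace 𝓘(ℝ, E) (c τ)) (S : Set ℝ) (t : ℝ)
    (u w : TangentSpace 𝓘(ℝ, E) (c t)) : Prop :=
  HasDerivWithinAt (F := E) (fun τ ↦ coord (c t) ⟨c τ, V τ⟩) (w - christoffel (c t) u (V t)) S t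

variable {c : ℝ → M} {V W : ∀ τ, TangentSpace 𝓘(ℝ, E) (c τ)} {S S' : Set ℝ} {t : ℝ}
  {u w w' : TangentSpace 𝓘(ℝ, E) (c t)}

theorem HasCovDerivWithinAt.unique (h : HasCovDerivWithinAt c V S t u w)
    (h' : HasCovDerivWithinAt c V S t u w') (hS : UniqueDiffWithinAt ℝ S t) : w = w' :=
  sub_left_injective (hS.eq_deriv _ h h')

variable [IsContMDiffRiemannianBundle 𝓘(ℝ, E) ∞ E (fun x : M ↦ TangentSpace 𝓘(ℝ, E) x)]

/-- The second derivative of the transition appears both when the coordinates are differentiated and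
when the Christoffel symbols change chart; the two contributions cancel, so any chart computes the
covariant derivative. -/
theorem hasCovDerivWithinAt_of_chart {p : M} {z' : E} (hp : c t ∈ (chartAt E p).source)
    (hu : HasVelocityWithinAt c S t u)
    (hz : HasDerivWithinAt (fun τ ↦ coord p ⟨c τ, V τ⟩) z' S t) :
    HasCovDerivWithinAt c V S t u
      (frame p (c t) (z' + chartChristoffel p (extChartAt 𝓘(ℝ, E) p (c t)) (coframe p (c t) u)
        (coframe p (c t) (V t)))) := by
  have h1 := hasDerivWithinAt_coord_frame hp (mem_chart_source E (c t)) hu.continuousWithinAt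
    (hu.hasDerivWithinAt_extChartAt hp) hz
  have h2 := leviCivita_frame_eq hp (coframe p (c t) u) (coframe p (c t) (V t))
  rw [leviCivita_frame hp, frame_coframe hp, frame_coframe hp] at h2
  have h3 := eq_sub_of_add_eq h2.symm
  rw [← frame_eq_fderiv hp, coord_eq_coframe hp] at h1
  unfold HasCovDerivWithinAt
  rw [map_add, add_sub_assoc, ← h3, add_comm]
  refine h1.congr_of_eventuallyEq ?_ ?_
  · filter_upwards [hu.continuousWithinAt.eventually ((chartAt E p).open_source.mem_nhds hp)]
      with τ hτ
    rw [frame_coord hτ]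
  · rw [frame_coord hp]

/-- The transition map shows that the coordinates at `p` have some derivative. Its value is then
forced by the previous lemma and uniqueness of covariant derivatives. -/
theorem HasCovDerivWithinAt.chart {p : M} (hp : c t ∈ (chartAt E p).source)
    (hu : HasVelocityWithinAt c S t u) (hw : HasCovDerivWithinAt c V S t u w)
    (hS : UniqueDiffWithinAt ℝ S t) :
    HasDerivWithinAt (fun τ ↦ coord p ⟨c τ, V τ⟩) (coframe p (c t) w -
      chartChristoffel p (extChartAt 𝓘(ℝ, E) p (c t)) (coframe p (c t) u)
        (coframe p (c t) (V t))) S t := by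
  have h0 := mem_chart_source E (c t)
  have h1 := hasDerivWithinAt_coord_frame h0 hp hu.continuousWithinAt
    (hu.hasDerivWithinAt_extChartAt h0) hw
  have h2 : ∃ z', HasDerivWithinAt (fun τ ↦ coord p ⟨c τ, V τ⟩) z' S t := by
    refine ⟨_, h1.congr_of_eventuallyEq ?_ ?_⟩
    · filter_upwards [hu.continuousWithinAt.eventually
        ((chartAt E (c t)).open_source.mem_nhds h0)] with τ hτ
      rw [frame_coord hτ]
    · rw [frame_coord h0]
  obtain ⟨z', hz⟩ := h2
  have h3 := (hasCovDerivWithinAt_of_chart hp hu hz).unique hw hS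
  rw [← h3, coframe_frame hp, add_sub_cancel_right]
  exact hz

theorem leviCivita_frame_self (q : M) (u : TangentSpace 𝓘(ℝ, E) q) (v : E) :
    leviCivita (fun r : M ↦ frame q r v) q u = christoffel q u v := by
  rw [leviCivita_apply]
  have h := coordDeriv_coordField q v
  rw [coordField_eq_frame] at h
  rw [h, frame_self]
  exact zero_add _

/-- Product rule for the metric matrix applied to two coordinate vectors, in the chart centred at `c
t`. The derivative of the matrix contributes exactly the Christoffel terms that complete the two
coordinate derivatives. -/
theorem HasCovDerivWithinAt.hasDerivWithinAt_inner (hu : HasVelocityWithinAt c S t u)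
    (hV : HasCovDerivWithinAt c V S t u w) (hW : HasCovDerivWithinAt c W S t u w') :
    HasDerivWithinAt (fun τ ↦ inner ℝ (V τ) (W τ)) (inner ℝ w (W t) + inner ℝ (V t) w') S t := by
  have h0 := mem_chart_source E (c t)
  have hy : extChartAt 𝓘(ℝ, E) (c t) (c t) ∈ (extChartAt 𝓘(ℝ, E) (c t)).target :=
    mem_extChartAt_target (c t)
  have h1 := (((contDiffOn_metricCoeff (c t)).contDiffAt
    ((isOpen_extChartAt_target (c t)).mem_nhds hy)).differentiableAt (by simp)).hasFDerivAt
  have h2 := h1.hasDerivWithinAt_clm_comp_apply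
    (y := fun τ ↦ extChartAt 𝓘(ℝ, E) (c t) (c τ)) (hu.hasDerivWithinAt_extChartAt h0) hV
  have h3 := h2.clm_apply hW
  have h4 : ∀ v : TangentSpace 𝓘(ℝ, E) (c t), coframe (E := E) (c t) (c t) v = v :=
    fun v ↦ coframe_self (E := E) (c t) v
  have h5 : ∀ v : TangentSpace 𝓘(ℝ, E) (c t), frame (E := E) (c t) (c t) v = v :=
    fun v ↦ frame_self (E := E) (c t) v
  have h6 := fderiv_metricCoeff (E := E) h0 u (V t) (W t)
  have h7 := leviCivita_frame_self (E := E) (c t) u (V t)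
  have h8 := leviCivita_frame_self (E := E) (c t) u (W t)
  have h9 := metricCoeff_extChartAt (E := E) h0 (w - christoffel (E := E) (c t) u (V t)) (W t)
  have h10 := metricCoeff_extChartAt (E := E) h0 (V t) (w' - christoffel (E := E) (c t) u (W t))
  rw [h5, h5] at h9 h10
  rw [h5 u, h5 (V t), h5 (W t), h7, h8] at h6
  rw [coord_self, coord_self, h4] at h3
  have h11 := congrArg₂ (· + ·) (congrArg₂ (· + ·) h6 h9) h10
  have h12 : (fun τ ↦ metricCoeff (c t) (extChartAt 𝓘(ℝ, E) (c t) (c τ)) (coord (c t) ⟨c τ, V τ⟩)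
      (coord (c t) ⟨c τ, W τ⟩)) =ᶠ[𝓝[S] t] fun τ ↦ inner ℝ (V τ) (W τ) := by
    filter_upwards [hu.continuousWithinAt.eventually
      ((chartAt E (c t)).open_source.mem_nhds h0)] with τ hτ
    rw [metricCoeff_extChartAt hτ, frame_coord hτ, frame_coord hτ]
  have h13 := metricCoeff_extChartAt (E := E) h0 (V t) (W t)
  rw [h5, h5] at h13
  refine (h3.congr_of_eventuallyEq h12.symm ?_).congr_deriv (h11.trans ?_)
  · rw [coord_self, coord_self]
    exact h13.symm
  · rw [inner_sub_left, inner_sub_right]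
    ring

theorem HasCovDerivWithinAt.congr (h : HasCovDerivWithinAt c V S t u w)
    (hVW : ∀ τ ∈ S, W τ = V τ) (ht : t ∈ S) : HasCovDerivWithinAt c W S t u w := by
  unfold HasCovDerivWithinAt
  rw [hVW t ht]
  exact HasDerivWithinAt.congr h (fun τ hτ ↦ by rw [hVW τ hτ]) (by rw [hVW t ht])

theorem HasCovDerivWithinAt.add (hc : ContinuousWithinAt c S t)
    (hV : HasCovDerivWithinAt c V S t u w) (hW : HasCovDerivWithinAt c W S t u w') :
    HasCovDerivWithinAt c (fun τ ↦ V τ + W τ) S t u (w + w') := by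
  have h0 := mem_chart_source E (c t)
  have h1 := HasDerivWithinAt.add hV hW
  have h2 : w + w' - christoffel (c t) u (V t + W t) =
      w - christoffel (c t) u (V t) + (w' - christoffel (c t) u (W t)) := by
    rw [christoffel_symm (c t) u, christoffel_add_left, christoffel_symm (c t) u,
      christoffel_symm (c t) u]
    abel
  unfold HasCovDerivWithinAt
  rw [h2]
  refine h1.congr_of_eventuallyEq ?_ (coord_add h0 _ _)
  filter_upwards [hc.eventually ((chartAt E (c t)).open_source.mem_nhds h0)] with τ hτ
  exact coord_add hτ _ _

theorem HasCovDerivWithinAt.const_smul (hc : ContinuousWithinAt c S t) (k : ℝ)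
    (hV : HasCovDerivWithinAt c V S t u w) :
    HasCovDerivWithinAt c (fun τ ↦ k • V τ) S t u (k • w) := by
  have h0 := mem_chart_source E (c t)
  have h1 := HasDerivWithinAt.const_smul k hV
  have h2 : k • w - christoffel (c t) u (k • V t) = k • (w - christoffel (c t) u (V t)) := by
    rw [christoffel_symm (c t) u, christoffel_smul_left, christoffel_symm (c t) u, smul_sub]
  unfold HasCovDerivWithinAt
  rw [h2]
  refine h1.congr_of_eventuallyEq ?_ (coord_smul h0 _ _)
  filter_upwards [hc.eventually ((chartAt E (c t)).open_source.mem_nhds h0)] with τ hτ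
  exact coord_smul hτ _ _

theorem HasCovDerivWithinAt.comp_mul_left {k : ℝ} {u w : TangentSpace 𝓘(ℝ, E) (c (k * t))}
    (hV : HasCovDerivWithinAt c V S (k * t) u w) (hS : MapsTo (fun τ ↦ k * τ) S' S) :
    HasCovDerivWithinAt (fun τ ↦ c (k * τ)) (fun τ ↦ V (k * τ)) S' t (k • u) (k • w) := by
  have h1 : HasDerivWithinAt (fun τ : ℝ ↦ k * τ) k S' t := by
    simpa using (hasDerivWithinAt_id t S').const_mul k
  have h2 := HasDerivWithinAt.scomp t hV h1 hS
  have h3 : k • w - christoffel (c (k * t)) (k • u) (V (k * t)) =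
      k • (w - christoffel (c (k * t)) u (V (k * t))) := by
    rw [christoffel_smul_left, smul_sub]
  unfold HasCovDerivWithinAt
  rw [h3]
  exact h2

theorem HasVelocityWithinAt.hasCovDerivWithinAt_comp {Y : Π x : M, TangentSpace 𝓘(ℝ, E) x}
    (hu : HasVelocityWithinAt c S t u)
    (hY : MDifferentiableAt 𝓘(ℝ, E) (𝓘(ℝ, E).prod 𝓘(ℝ, E))
      (fun q ↦ TotalSpace.mk' E (E := fun y : M ↦ TangentSpace 𝓘(ℝ, E) y) q (Y q)) (c t)) :
    HasCovDerivWithinAt c (fun τ ↦ Y (c τ)) S t u (leviCivita Y (c t) u) := by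
  have h1 := hu.hasDerivWithinAt_comp (mdifferentiableAt_coord hY)
  unfold HasCovDerivWithinAt
  rw [leviCivita_apply, add_sub_cancel_right]
  exact h1

theorem HasCovDerivWithinAt.covDerivAlong_eq (hu : HasVelocityWithinAt c S t u)
    (hV : HasCovDerivWithinAt c V S t u w) (hS : UniqueDiffWithinAt ℝ S t) :
    covDerivAlong (fun τ ↦ (⟨c τ, V τ⟩ : TangentBundle 𝓘(ℝ, E) M)) S t = w := by
  have h1 : (derivWithin (fun τ ↦ coord (c t) ⟨c τ, V τ⟩) S t : E) =
      w - christoffel (c t) u (V t) := HasDerivWithinAt.derivWithin hV hS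
  have h2 := hu.velocity_eq hS
  simp only [covDerivAlong]
  rw [h1, h2]
  exact sub_add_cancel _ _

theorem HasCovDerivWithinAt.mdifferentiableWithinAt (hu : HasVelocityWithinAt c S t u)
    (hV : HasCovDerivWithinAt c V S t u w) :
    MDifferentiableWithinAt 𝓘(ℝ) 𝓘(ℝ, E).tangent
      (fun τ ↦ (⟨c τ, V τ⟩ : TangentBundle 𝓘(ℝ, E) M)) S t :=
  (mdifferentiableWithinAt_totalSpace ..).2 ⟨HasMFDerivWithinAt.mdifferentiableWithinAt hu,
    (HasDerivWithinAt.differentiableWithinAt hV).mdifferentiableWithinAt⟩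

theorem hasCovDerivWithinAt_covDerivAlong
    (hV : MDifferentiableWithinAt 𝓘(ℝ) 𝓘(ℝ, E).tangent
      (fun τ ↦ (⟨c τ, V τ⟩ : TangentBundle 𝓘(ℝ, E) M)) S t) :
    HasCovDerivWithinAt c V S t (velocity c S t)
      (covDerivAlong (fun τ ↦ (⟨c τ, V τ⟩ : TangentBundle 𝓘(ℝ, E) M)) S t) := by
  have h1 : DifferentiableWithinAt ℝ (fun τ ↦ coord (c t) ⟨c τ, V τ⟩) S t :=
    ((mdifferentiableWithinAt_totalSpace ..).1 hV).2.differentiableWithinAt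
  exact h1.hasDerivWithinAt.congr_deriv (add_sub_cancel_right _ _).symm

end CovDeriv

/-! ### Separation in the tangent bundle -/

section TangentBundle

variable {E : Type*} [NormedAddCommGroup E] [NormedSpace ℝ E]
  {M : Type*} [TopologicalSpace M] [ChartedSpace E M] [IsManifold 𝓘(ℝ, E) ∞ M]

/-- Vectors over different points are separated in the base, vectors over the same point in a
trivialization. This makes the set of times where two velocity curves agree closed. -/
theorem t2Space_tangentBundle [T2Space M] : T2Space (TangentBundle 𝓘(ℝ, E) M) := by
  refine ⟨fun a b hab ↦ ?_⟩
  have hproj : Continuous (fun a : TangentBundle 𝓘(ℝ, E) M ↦ a.proj) :=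
    FiberBundle.continuous_proj E (TangentSpace 𝓘(ℝ, E) (M := M))
  by_cases h : a.proj = b.proj
  · let e := trivializationAt E (TangentSpace 𝓘(ℝ, E) (M := M)) a.proj
    have ha : a ∈ e.source := FiberBundle.mem_trivializationAt_proj_source
    have hb : b ∈ e.source := by
      rw [e.mem_source, ← h]
      exact FiberBundle.mem_baseSet_trivializationAt' _
    have hne : e a ≠ e b := fun h ↦ hab (e.injOn ha hb h)
    obtain ⟨U, V, hU, hV, haU, hbV, hUV⟩ := t2_separation hne
    refine ⟨e.source ∩ e ⁻¹' U, e.source ∩ e ⁻¹' V, e.toOpenPartialHomeomorph.isOpen_inter_preimage hU,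
      e.toOpenPartialHomeomorph.isOpen_inter_preimage hV, ⟨ha, haU⟩, ⟨hb, hbV⟩, ?_⟩
    exact (hUV.preimage e).mono inter_subset_right inter_subset_right
  · obtain ⟨U, V, hU, hV, haU, hbV, hUV⟩ := t2_separation h
    exact ⟨_, _, hU.preimage hproj, hV.preimage hproj, haU, hbV, hUV.preimage _⟩

theorem tangentBundle_ext_chart {p : M} {a b : TangentBundle 𝓘(ℝ, E) M}
    (ha : a.proj ∈ (chartAt E p).source) (hb : b.proj ∈ (chartAt E p).source)
    (h : extChartAt 𝓘(ℝ, E) p a.proj = extChartAt 𝓘(ℝ, E) p b.proj)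
    (h' : coord p a = coord p b) : a = b := by
  have h1 : a.proj = b.proj :=
    (extChartAt 𝓘(ℝ, E) p).injOn (by simpa using ha) (by simpa using hb) h
  let e := trivializationAt E (TangentSpace 𝓘(ℝ, E) (M := M)) p
  have ha' : a ∈ e.source := e.mem_source.2 ha
  have hb' : b ∈ e.source := e.mem_source.2 hb
  refine e.injOn ha' hb' (Prod.ext ?_ h')
  exact (e.coe_fst ha').trans (h1.trans (e.coe_fst hb').symm)

end TangentBundle

/-! ### Uniqueness and rescaling of geodesics -/

section Geodesic

variable {E : Type*} [NormedAddCommGroup E] [NormedSpace ℝ E] [FiniteDimensional ℝ E]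
  {M : Type*} [TopologicalSpace M] [ChartedSpace E M] [IsManifold 𝓘(ℝ, E) ∞ M]
  [RiemannianBundle (fun x : M ↦ TangentSpace 𝓘(ℝ, E) x)]
  [IsContMDiffRiemannianBundle 𝓘(ℝ, E) ∞ E (fun x : M ↦ TangentSpace 𝓘(ℝ, E) x)]

theorem IsGeodesicOn.hasVelocityWithinAt {γ : ℝ → M} {J : Set ℝ}
    (h : IsGeodesicOn (E := E) γ J) {t : ℝ} (ht : t ∈ J) :
    HasVelocityWithinAt (E := E) γ J t (velocity γ J t) :=
  hasVelocityWithinAt_velocity ((h.1 t ht).mdifferentiableWithinAt (by simp))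

/-- The velocity curve is the tangent map of `γ` composed with the smooth unit section `τ ↦ (τ, 1)`.
-/
theorem contMDiffOn_velocity {γ : ℝ → M} {J : Set ℝ}
    (h : ContMDiffOn 𝓘(ℝ) 𝓘(ℝ, E) ∞ γ J) (hJ : UniqueDiffOn ℝ J) :
    ContMDiffOn 𝓘(ℝ) 𝓘(ℝ, E).tangent ∞
      (fun τ ↦ (⟨γ τ, velocity γ J τ⟩ : TangentBundle 𝓘(ℝ, E) M)) J := by
  have h1 := h.contMDiffOn_tangentMapWithin (m := ∞) (by simp) hJ.uniqueMDiffOn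
  have h2 : ContMDiff 𝓘(ℝ) 𝓘(ℝ).tangent ∞ (fun τ : ℝ ↦ (⟨τ, (1 : ℝ)⟩ : TangentBundle 𝓘(ℝ) ℝ)) := by
    intro τ
    rw [contMDiffAt_totalSpace]
    refine ⟨contMDiffAt_id, ?_⟩
    simp only [trivializationAt_model_space_apply]
    exact contMDiffAt_const
  exact h1.comp h2.contMDiffOn fun t ht ↦ ht

theorem IsGeodesicOn.hasCovDerivWithinAt {γ : ℝ → M} {J : Set ℝ}
    (h : IsGeodesicOn (E := E) γ J) (hJ : UniqueDiffOn ℝ J) {t : ℝ} (ht : t ∈ J) :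
    HasCovDerivWithinAt (E := E) γ (fun τ ↦ velocity γ J τ) J t (velocity γ J t) 0 := by
  rw [← h.2 t ht]
  exact hasCovDerivWithinAt_covDerivAlong
    ((contMDiffOn_velocity h.1 hJ t ht).mdifferentiableWithinAt (by simp))

/-- The geodesic equation in a chart, as a first-order system. -/
theorem IsGeodesicOn.hasDerivWithinAt_chart {γ : ℝ → M} {J : Set ℝ}
    (h : IsGeodesicOn (E := E) γ J) (hJ : UniqueDiffOn ℝ J) {t : ℝ} (ht : t ∈ J) {p : M}
    (hp : γ t ∈ (chartAt E p).source) :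
    HasDerivWithinAt (fun τ ↦ (extChartAt 𝓘(ℝ, E) p (γ τ), coord p ⟨γ τ, velocity γ J τ⟩))
      (coord p ⟨γ t, velocity γ J t⟩, -chartChristoffel p (extChartAt 𝓘(ℝ, E) p (γ t))
        (coord p ⟨γ t, velocity γ J t⟩) (coord p ⟨γ t, velocity γ J t⟩)) J t := by
  have h1 := (h.hasVelocityWithinAt ht).hasDerivWithinAt_extChartAt hp
  have h2 := (h.hasCovDerivWithinAt hJ ht).chart hp (h.hasVelocityWithinAt ht) (hJ t ht)
  rw [map_zero, zero_sub] at h2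
  rw [coord_eq_coframe hp]
  exact h1.prodMk h2

/-- Two geodesics which agree, to first order, at a time `t` agree on a short time interval
after `t`. -/
theorem IsGeodesicOn.eventually_eq {γ₁ γ₂ : ℝ → M} {a b : ℝ}
    (h₁ : IsGeodesicOn (E := E) γ₁ (Icc a b)) (h₂ : IsGeodesicOn (E := E) γ₂ (Icc a b)) {t : ℝ}
    (ht : t ∈ Ico a b)
    (heq : (⟨γ₁ t, velocity γ₁ (Icc a b) t⟩ : TangentBundle 𝓘(ℝ, E) M) =
      ⟨γ₂ t, velocity γ₂ (Icc a b) t⟩) :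
    ∀ᶠ τ in 𝓝[>] t, (⟨γ₁ τ, velocity γ₁ (Icc a b) τ⟩ : TangentBundle 𝓘(ℝ, E) M) =
      ⟨γ₂ τ, velocity γ₂ (Icc a b) τ⟩ := by
  have hJ : UniqueDiffOn ℝ (Icc a b) := uniqueDiffOn_Icc (ht.1.trans_lt ht.2)
  have htJ : t ∈ Icc a b := Ico_subset_Icc_self ht
  obtain ⟨p, hp⟩ : ∃ p, p = γ₁ t := ⟨_, rfl⟩
  have hp₁ : γ₁ t ∈ (chartAt E p).source := by rw [hp]; exact mem_chart_source E _
  have hp₂ : γ₂ t ∈ (chartAt E p).source := by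
    have h0 : γ₁ t = γ₂ t := congrArg TotalSpace.proj heq
    rwa [← h0]
  let F : E × E → E × E := fun a ↦ (a.2, -chartChristoffel p a.1 a.2 a.2)
  let c (γ : ℝ → M) (τ : ℝ) : E × E :=
    (extChartAt 𝓘(ℝ, E) p (γ τ), coord p ⟨γ τ, velocity γ (Icc a b) τ⟩)
  have hc : c γ₁ t = c γ₂ t :=
    congrArg (fun v : TangentBundle 𝓘(ℝ, E) M ↦ (extChartAt 𝓘(ℝ, E) p v.proj, coord p v)) heq
  have hy : extChartAt 𝓘(ℝ, E) p (γ₁ t) ∈ (extChartAt 𝓘(ℝ, E) p).target :=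
    (extChartAt 𝓘(ℝ, E) p).map_source (by simpa using hp₁)
  have hF : ContDiffAt ℝ 1 F (c γ₁ t) := by
    have h3 := ((contDiffOn_chartChristoffel (E := E) p).contDiffAt
      (((isOpen_extChartAt_target (I := 𝓘(ℝ, E)) p).prod isOpen_univ).mem_nhds
        (show c γ₁ t ∈ _ from ⟨hy, mem_univ _⟩))).of_le (m := 1) (by simp)
    exact contDiffAt_snd.prodMk (h3.clm_apply contDiffAt_snd).neg
  -- A `C¹` field is Lipschitz near the initial state, which is what ODE uniqueness needs.
  obtain ⟨K, s, hs, hK⟩ := hF.exists_lipschitzOnWith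
  -- For a short time both curves stay in the chart and in the Lipschitz region. Staying in the
  -- half-open `Ico a b` lets derivatives within `Icc a b` serve as right derivatives.
  have hnear : ∀ γ : ℝ → M, IsGeodesicOn (E := E) γ (Icc a b) → γ t ∈ (chartAt E p).source →
      c γ t = c γ₁ t →
      ∀ᶠ τ in 𝓝[≥] t, τ ∈ Ico a b ∧ γ τ ∈ (chartAt E p).source ∧ c γ τ ∈ s := by
    intro γ hγ hpγ hcγ
    have h3 : Icc a b ∈ 𝓝[≥] t := Icc_mem_nhdsGE_of_mem ht
    have h4 : Ico a b ∈ 𝓝[≥] t := Ico_mem_nhdsGE_of_mem ht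
    have h5 : 𝓝[≥] t ≤ 𝓝[Icc a b] t := nhdsWithin_le_of_mem h3
    have h6 := (hγ.hasVelocityWithinAt htJ).continuousWithinAt.eventually
      ((chartAt E p).open_source.mem_nhds hpγ)
    have h7 := (hγ.hasDerivWithinAt_chart hJ htJ hpγ).continuousWithinAt.eventually
      (p := fun v ↦ v ∈ s) (by rw [← hcγ] at hs; exact hs)
    filter_upwards [h4, h5 h6, h5 h7] with τ h8 h9 h10 using ⟨h8, h9, h10⟩
  obtain ⟨d, hd, hd'⟩ := (mem_nhdsGE_iff_exists_Icc_subset).1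
    ((hnear γ₁ h₁ hp₁ rfl).and (hnear γ₂ h₂ hp₂ hc.symm))
  have hderiv : ∀ γ : ℝ → M, IsGeodesicOn (E := E) γ (Icc a b) → ∀ τ ∈ Icc t d,
      τ ∈ Ico a b → γ τ ∈ (chartAt E p).source → HasDerivWithinAt (c γ) (F (c γ τ)) (Icc a b) τ :=
    fun γ hγ τ _ h8 h9 ↦ hγ.hasDerivWithinAt_chart hJ (Ico_subset_Icc_self h8) h9
  have hsub : Icc t d ⊆ Icc a b := fun τ hτ ↦ Ico_subset_Icc_self (hd' hτ).1.1
  have huniq := ODE_solution_unique_of_mem_Icc_right (v := fun _ ↦ F) (s := fun _ ↦ s) (K := K)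
    (f := c γ₁) (g := c γ₂) (a := t) (b := d) (fun _ _ ↦ hK)
    (fun τ hτ ↦ (hderiv γ₁ h₁ τ hτ (hd' hτ).1.1 (hd' hτ).1.2.1).continuousWithinAt.mono hsub)
    (fun τ hτ ↦ (hderiv γ₁ h₁ τ (Ico_subset_Icc_self hτ) (hd' (Ico_subset_Icc_self hτ)).1.1
      (hd' (Ico_subset_Icc_self hτ)).1.2.1).mono_of_mem_nhdsWithin
      (Icc_mem_nhdsGE_of_mem (hd' (Ico_subset_Icc_self hτ)).1.1))
    (fun τ hτ ↦ (hd' (Ico_subset_Icc_self hτ)).1.2.2)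
    (fun τ hτ ↦ (hderiv γ₂ h₂ τ hτ (hd' hτ).2.1 (hd' hτ).2.2.1).continuousWithinAt.mono hsub)
    (fun τ hτ ↦ (hderiv γ₂ h₂ τ (Ico_subset_Icc_self hτ) (hd' (Ico_subset_Icc_self hτ)).2.1
      (hd' (Ico_subset_Icc_self hτ)).2.2.1).mono_of_mem_nhdsWithin
      (Icc_mem_nhdsGE_of_mem (hd' (Ico_subset_Icc_self hτ)).2.1))
    (fun τ hτ ↦ (hd' (Ico_subset_Icc_self hτ)).2.2.2) hc
  filter_upwards [Icc_mem_nhdsGT hd] with τ hτ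
  have h11 := huniq hτ
  have h12 : (c γ₁ τ).2 = (c γ₂ τ).2 := by rw [h11]
  exact tangentBundle_ext_chart (hd' hτ).1.2.1 (hd' hτ).2.2.1 (congrArg Prod.fst h11) h12

/-- Continuous induction: the agreement set of the velocity curves is closed, contains `0`, and
extends to the right of each of its points before `1`. -/
theorem IsGeodesicFrom.eqOn [T2Space M] {x : M} {s : TangentSpace 𝓘(ℝ, E) x} {γ₁ γ₂ : ℝ → M}
    (h₁ : IsGeodesicFrom x s γ₁) (h₂ : IsGeodesicFrom x s γ₂) : EqOn γ₁ γ₂ (Icc 0 1) := by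
  have hT2 := t2Space_tangentBundle (E := E) (M := M)
  let Z (γ : ℝ → M) (τ : ℝ) : TangentBundle 𝓘(ℝ, E) M := ⟨γ τ, velocity γ (Icc 0 1) τ⟩
  have hJ : UniqueDiffOn ℝ (Icc (0 : ℝ) 1) := uniqueDiffOn_Icc one_pos
  have hsub : Icc (0 : ℝ) 1 ⊆ {τ | Z γ₁ τ = Z γ₂ τ} := by
    refine IsClosed.Icc_subset_of_forall_mem_nhdsWithin ?_ (h₁.2.trans h₂.2.symm)
      fun t ht ↦ h₁.1.eventually_eq h₂.1 ht.2 ht.1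
    have h3 : ContinuousOn (fun τ ↦ (Z γ₁ τ, Z γ₂ τ)) (Icc 0 1) :=
      (contMDiffOn_velocity h₁.1.1 hJ).continuousOn.prodMk
        (contMDiffOn_velocity h₂.1.1 hJ).continuousOn
    have h4 := h3.preimage_isClosed_of_isClosed isClosed_Icc isClosed_diagonal
    rwa [inter_comm]
  exact fun τ hτ ↦ congrArg TotalSpace.proj (hsub hτ)

/-- Slowing time by `k` multiplies the velocity by `k` and the acceleration by `k ^ 2`, so zero
acceleration persists. The value `k = 0` is included and gives the constant geodesic. -/
theorem IsGeodesicFrom.comp_mul_left {x : M} {s : TangentSpace 𝓘(ℝ, E) x} {γ : ℝ → M}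
    (h : IsGeodesicFrom x s γ) {k : ℝ} (hk : k ∈ Icc (0 : ℝ) 1) :
    IsGeodesicFrom x (k • s) (fun τ ↦ γ (k * τ)) := by
  have hJ : UniqueDiffOn ℝ (Icc (0 : ℝ) 1) := uniqueDiffOn_Icc one_pos
  have hmaps : MapsTo (fun τ ↦ k * τ) (Icc (0 : ℝ) 1) (Icc 0 1) := fun τ hτ ↦
    ⟨mul_nonneg hk.1 hτ.1, mul_le_one₀ hk.2 hτ.1 hτ.2⟩
  have hvel : ∀ τ ∈ Icc (0 : ℝ) 1, HasVelocityWithinAt (E := E) (fun τ ↦ γ (k * τ)) (Icc 0 1) τ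
      (k • velocity γ (Icc 0 1) (k * τ)) := fun τ hτ ↦
    (h.1.hasVelocityWithinAt (hmaps hτ)).comp_mul_left hmaps
  have hveq : ∀ τ ∈ Icc (0 : ℝ) 1, velocity (E := E) (fun τ ↦ γ (k * τ)) (Icc 0 1) τ =
      k • velocity γ (Icc 0 1) (k * τ) := fun τ hτ ↦ (hvel τ hτ).velocity_eq (hJ τ hτ)
  refine ⟨⟨?_, fun τ hτ ↦ ?_⟩, ?_⟩
  · have h1 : ContMDiff 𝓘(ℝ) 𝓘(ℝ) ∞ (fun τ : ℝ ↦ k * τ) :=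
      (contDiff_const.mul contDiff_id).contMDiff
    exact h.1.1.comp h1.contMDiffOn hmaps
  · have h1 := (h.1.hasCovDerivWithinAt hJ (hmaps hτ)).comp_mul_left (t := τ) hmaps
    have h2 := h1.const_smul (hvel τ hτ).continuousWithinAt k
    rw [smul_zero, smul_zero] at h2
    have h3 := h2.congr (W := fun τ ↦ velocity (fun τ ↦ γ (k * τ)) (Icc 0 1) τ) hveq hτ
    exact h3.covDerivAlong_eq (hvel τ hτ) (hJ τ hτ)
  · have h0 := hveq 0 (left_mem_Icc.2 zero_le_one)
    have h1 : (⟨γ (k * 0), k • velocity γ (Icc 0 1) (k * 0)⟩ : TangentBundle 𝓘(ℝ, E) M) =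
        ⟨x, k • s⟩ := by
      rw [mul_zero]
      exact congrArg (fun v : TangentBundle 𝓘(ℝ, E) M ↦
        (⟨v.proj, k • v.snd⟩ : TangentBundle 𝓘(ℝ, E) M)) h.2
    rw [h0]
    exact h1

theorem expMap_smul_eq [T2Space M] {x : M} {s : TangentSpace 𝓘(ℝ, E) x} {γ : ℝ → M}
    (h : IsGeodesicFrom x s γ) {k : ℝ} (hk : k ∈ Icc (0 : ℝ) 1) : expMap x (k • s) = γ k := by
  have h1 := h.comp_mul_left hk
  have h2 : ∃ γ : ℝ → M, IsGeodesicFrom x (k • s) γ := ⟨_, h1⟩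
  rw [expMap, dif_pos h2]
  simpa using h2.choose_spec.eqOn h1 (right_mem_Icc.2 zero_le_one)

end Geodesic

/-! ### Linear differential equations on short intervals -/

section LinearODE

variable {E : Type*} [NormedAddCommGroup E] [NormedSpace ℝ E] [CompleteSpace E]

/-- A linear differential equation has a solution on a sufficiently short time interval, whose
length does not depend on the initial value. -/
theorem exists_solution_linear_ode {A : ℝ → E →L[ℝ] E} {a b K : ℝ} (hab : a ≤ b)
    (hA : ContinuousOn A (Icc a b)) (hK : ∀ t ∈ Icc a b, ‖A t‖ ≤ K) (hshort : 2 * K * (b - a) ≤ 1)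
    (w : E) :
    ∃ z : ℝ → E, z a = w ∧ ∀ t ∈ Icc a b, HasDerivWithinAt z (A t (z t)) (Icc a b) t := by
  have hK0 : 0 ≤ K := (norm_nonneg _).trans (hK a (left_mem_Icc.2 hab))
  -- On the ball of radius `‖w‖` around `w` vectors have norm at most `2‖w‖`, so the speed is at
  -- most `2K‖w‖`. The condition `hshort` keeps the solution in this ball, whatever `w` is.
  have hpl : IsPicardLindelof (fun t v ↦ A t v) (tmin := a) (tmax := b) ⟨a, left_mem_Icc.2 hab⟩ w
      ‖w‖₊ 0 (⟨K, hK0⟩ * (2 * ‖w‖₊)) ⟨K, hK0⟩ := by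
    refine ⟨fun t ht ↦ ?_, fun v _ ↦ hA.clm_apply continuousOn_const, fun t ht v hv ↦ ?_, ?_⟩
    · exact ((A t).lipschitz.weaken (hK t ht)).lipschitzOnWith
    · have h1 : ‖v‖ ≤ 2 * ‖w‖ := by
        have h2 := norm_le_norm_add_norm_sub' v w
        have h3 : ‖v - w‖ ≤ ‖w‖ := by simpa [dist_eq_norm] using hv
        linarith
      exact ((A t).le_opNorm v).trans (mul_le_mul (hK t ht) h1 (norm_nonneg _) hK0)
    · have h1 : max (b - a) (a - a) = b - a := max_eq_left (by linarith)
      have h2 : K * (2 * ‖w‖) * (b - a) ≤ ‖w‖ := by nlinarith [norm_nonneg w]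
      simp only [h1, NNReal.coe_zero, sub_zero]
      exact h2
  exact hpl.exists_eq_forall_mem_Icc_hasDerivWithinAt₀

end LinearODE

/-! ### Existence and uniqueness of parallel fields -/

section Parallel

variable {E : Type*} [NormedAddCommGroup E] [NormedSpace ℝ E] [FiniteDimensional ℝ E]
  {M : Type*} [TopologicalSpace M] [ChartedSpace E M] [IsManifold 𝓘(ℝ, E) ∞ M]
  [RiemannianBundle (fun x : M ↦ TangentSpace 𝓘(ℝ, E) x)]
  [IsContMDiffRiemannianBundle 𝓘(ℝ, E) ∞ E (fun x : M ↦ TangentSpace 𝓘(ℝ, E) x)]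

/-- The vector field `V` along the curve `γ`, defined on `[0, 1]`, is parallel on `S ⊆ [0, 1]`. -/
def IsParallelAlong (γ : ℝ → M) (V : ∀ τ, TangentSpace 𝓘(ℝ, E) (γ τ)) (S : Set ℝ) : Prop :=
  ∀ t ∈ S, HasCovDerivWithinAt γ V S t (velocity γ (Icc 0 1) t) 0

variable {γ : ℝ → M}

theorem IsParallelAlong.glue {V W : ∀ τ, TangentSpace 𝓘(ℝ, E) (γ τ)} {a m b : ℝ}
    (ham : a ≤ m) (hmb : m ≤ b) (hV : IsParallelAlong γ V (Icc a m))
    (hW : IsParallelAlong γ W (Icc m b)) (hVW : W m = V m) :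
    ∃ Y : ∀ τ, TangentSpace 𝓘(ℝ, E) (γ τ), IsParallelAlong γ Y (Icc a b) ∧ Y a = V a := by
  classical
  let Y : ∀ τ, TangentSpace 𝓘(ℝ, E) (γ τ) := fun τ ↦ if τ ≤ m then V τ else W τ
  have hYV : ∀ τ ∈ Icc a m, Y τ = V τ := fun τ hτ ↦ if_pos hτ.2
  have hYW : ∀ τ ∈ Icc m b, Y τ = W τ := by
    intro τ hτ
    rcases hτ.1.eq_or_lt with rfl | h
    · exact (if_pos le_rfl).trans hVW.symm
    · exact if_neg h.not_ge
  refine ⟨Y, fun t ht ↦ ?_, hYV a (left_mem_Icc.2 ham)⟩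
  have h1 : HasCovDerivWithinAt γ Y (Icc a m) t (velocity γ (Icc 0 1) t) 0 := by
    by_cases h : t ∈ Icc a m
    · exact (hV t h).congr hYV h
    -- Off a closed interval the derivative within it is unconstrained, so both one-sided statements
    -- hold at every `t` and can be united.
    · exact HasFDerivWithinAt.of_notMem_closure (by rwa [closure_Icc])
  have h2 : HasCovDerivWithinAt γ Y (Icc m b) t (velocity γ (Icc 0 1) t) 0 := by
    by_cases h : t ∈ Icc m b
    · exact (hW t h).congr hYW h
    · exact HasFDerivWithinAt.of_notMem_closure (by rwa [closure_Icc])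
  have h3 := HasDerivWithinAt.union h1 h2
  rw [Icc_union_Icc_eq_Icc ham hmb] at h3
  exact h3

/-- In the fixed chart at `γ t₀` parallelism is a linear equation. The neighbourhood `O` serves all
subintervals and all initial vectors, which allows a finite subdivision afterwards. -/
theorem exists_isParallelAlong_local (hγ : ContMDiffOn 𝓘(ℝ) 𝓘(ℝ, E) ∞ γ (Icc 0 1)) {t₀ : ℝ}
    (ht₀ : t₀ ∈ Icc (0 : ℝ) 1) :
    ∃ O : Set ℝ, IsOpen O ∧ t₀ ∈ O ∧ ∀ a b, a ≤ b → Icc a b ⊆ O ∩ Icc 0 1 →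
      ∀ w : TangentSpace 𝓘(ℝ, E) (γ a), ∃ V : ∀ τ, TangentSpace 𝓘(ℝ, E) (γ τ),
        IsParallelAlong γ V (Icc a b) ∧ V a = w := by
  have hJ : UniqueDiffOn ℝ (Icc (0 : ℝ) 1) := uniqueDiffOn_Icc one_pos
  obtain ⟨p, hp⟩ : ∃ p, p = γ t₀ := ⟨_, rfl⟩
  have hp₀ : γ t₀ ∈ (chartAt E p).source := by rw [hp]; exact mem_chart_source E _
  let A : ℝ → E →L[ℝ] E := fun τ ↦ -chartChristoffel p (extChartAt 𝓘(ℝ, E) p (γ τ))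
    (coord p ⟨γ τ, velocity γ (Icc 0 1) τ⟩)
  have hA : ∀ τ ∈ Icc (0 : ℝ) 1, γ τ ∈ (chartAt E p).source →
      ContinuousWithinAt A (Icc 0 1) τ := by
    intro τ hτ hpτ
    let e := trivializationAt E (TangentSpace 𝓘(ℝ, E) (M := M)) p
    have hZ := (contMDiffOn_velocity hγ hJ).continuousOn τ hτ
    have he : ContinuousAt e (⟨γ τ, velocity γ (Icc 0 1) τ⟩ : TangentBundle 𝓘(ℝ, E) M) :=
      e.continuousAt (e.mem_source.2 hpτ)
    have h1 : ContinuousWithinAt (fun τ ↦ coord p ⟨γ τ, velocity γ (Icc 0 1) τ⟩) (Icc 0 1) τ :=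
      continuous_snd.continuousAt.comp_continuousWithinAt (he.comp_continuousWithinAt (x := τ) hZ)
    have h2 : ContinuousWithinAt (fun τ ↦ extChartAt 𝓘(ℝ, E) p (γ τ)) (Icc 0 1) τ :=
      (continuousAt_extChartAt' (I := 𝓘(ℝ, E)) (by simpa using hpτ)).comp_continuousWithinAt
        (hγ.continuousOn τ hτ)
    have hy : extChartAt 𝓘(ℝ, E) p (γ τ) ∈ (extChartAt 𝓘(ℝ, E) p).target :=
      (extChartAt 𝓘(ℝ, E) p).map_source (by simpa using hpτ)
    have h3 := ((contDiffOn_chartChristoffel (E := E) p).contDiffAt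
      (((isOpen_extChartAt_target (I := 𝓘(ℝ, E)) p).prod isOpen_univ).mem_nhds
        (show (extChartAt 𝓘(ℝ, E) p (γ τ), coord p ⟨γ τ, velocity γ (Icc 0 1) τ⟩) ∈ _ from
          ⟨hy, mem_univ _⟩))).continuousAt
    exact (h3.comp_continuousWithinAt (f := fun τ ↦ (extChartAt 𝓘(ℝ, E) p (γ τ),
      coord p ⟨γ τ, velocity γ (Icc 0 1) τ⟩)) (h2.prodMk h1)).neg
  have hev : ∀ᶠ τ in 𝓝[Icc 0 1] t₀, γ τ ∈ (chartAt E p).source ∧ ‖A τ‖ < ‖A t₀‖ + 1 :=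
    ((hγ.continuousOn t₀ ht₀).eventually ((chartAt E p).open_source.mem_nhds hp₀)).and
      ((hA t₀ ht₀ hp₀).norm.eventually (gt_mem_nhds (lt_add_one _)))
  obtain ⟨O, hO, ht₀O, hO'⟩ := mem_nhdsWithin.1 hev
  have hK0 : 0 < ‖A t₀‖ + 1 := by positivity
  -- With `K = ‖A t₀‖ + 1`, two points of this ball are less than `1 / (2K)` apart, as the
  -- short-time existence result requires.
  refine ⟨O ∩ Metric.ball t₀ (1 / (4 * (‖A t₀‖ + 1))), hO.inter Metric.isOpen_ball,
    ⟨ht₀O, Metric.mem_ball_self (by positivity)⟩, fun a b hab hsub w ↦ ?_⟩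
  have hsubJ : Icc a b ⊆ Icc 0 1 := fun τ hτ ↦ (hsub hτ).2
  have hmem : ∀ τ ∈ Icc a b, γ τ ∈ (chartAt E p).source ∧ ‖A τ‖ < ‖A t₀‖ + 1 :=
    fun τ hτ ↦ hO' ⟨(hsub hτ).1.1, hsubJ hτ⟩
  have hshort : 2 * (‖A t₀‖ + 1) * (b - a) ≤ 1 := by
    have h1 := (hsub (left_mem_Icc.2 hab)).1.2
    have h2 := (hsub (right_mem_Icc.2 hab)).1.2
    rw [Real.ball_eq_Ioo] at h1 h2
    have h3 : b - a ≤ 2 * (1 / (4 * (‖A t₀‖ + 1))) := by linarith [h1.1, h2.2]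
    calc 2 * (‖A t₀‖ + 1) * (b - a)
        ≤ 2 * (‖A t₀‖ + 1) * (2 * (1 / (4 * (‖A t₀‖ + 1)))) := by gcongr
      _ = 1 := by field_simp; norm_num
  obtain ⟨z, hza, hz⟩ := exists_solution_linear_ode hab
    (fun τ hτ ↦ (hA τ (hsubJ hτ) (hmem τ hτ).1).mono hsubJ) (fun τ hτ ↦ (hmem τ hτ).2.le) hshort
    (coframe p (γ a) w)
  refine ⟨fun τ ↦ frame p (γ τ) (z τ), fun t ht ↦ ?_, ?_⟩
  · have h1 : HasDerivWithinAt (fun τ ↦ coord p ⟨γ τ, frame p (γ τ) (z τ)⟩) (A t (z t))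
        (Icc a b) t :=
      (hz t ht).congr (fun τ hτ ↦ coord_frame (hmem τ hτ).1 _) (coord_frame (hmem t ht).1 _)
    have hvel := (hasVelocityWithinAt_velocity
      ((hγ t (hsubJ ht)).mdifferentiableWithinAt (by simp))).mono hsubJ
    have h2 := hasCovDerivWithinAt_of_chart (hmem t ht).1 hvel h1
    rw [coframe_frame (hmem t ht).1, ← coord_eq_coframe (hmem t ht).1,
      show A t (z t) = -chartChristoffel p (extChartAt 𝓘(ℝ, E) p (γ t))
        (coord p ⟨γ t, velocity γ (Icc 0 1) t⟩) (z t) from rfl, neg_add_cancel, map_zero] at h2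
    exact h2
  · beta_reduce
    rw [hza, frame_coframe (hmem a (left_mem_Icc.2 hab)).1]

/-- Existence of parallel fields along a smooth curve on `[0, 1]`. -/
theorem exists_isParallelAlong (hγ : ContMDiffOn 𝓘(ℝ) 𝓘(ℝ, E) ∞ γ (Icc 0 1))
    (v : TangentSpace 𝓘(ℝ, E) (γ 0)) :
    ∃ V : ∀ τ, TangentSpace 𝓘(ℝ, E) (γ τ), IsParallelAlong γ V (Icc 0 1) ∧ V 0 = v := by
  choose O hO hmem hloc using fun t : Icc (0 : ℝ) 1 ↦ exists_isParallelAlong_local hγ t.2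
  -- By compactness there is a finite subdivision of `[0, 1]`, each piece lying in one `O t`; the
  -- field is extended piece by piece.
  obtain ⟨σ, hσ0, hσm, ⟨N, hN⟩, hσ⟩ := exists_monotone_Icc_subset_open_cover_Icc
    (zero_le_one (α := ℝ)) (c := fun t ↦ Subtype.val ⁻¹' O t)
    (fun t ↦ (hO t).preimage continuous_subtype_val)
    (fun t _ ↦ mem_iUnion.2 ⟨t, hmem t⟩)
  have key : ∀ n, ∃ V : ∀ τ, TangentSpace 𝓘(ℝ, E) (γ τ),
      IsParallelAlong γ V (Icc 0 (σ n : ℝ)) ∧ V 0 = v := by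
    intro n
    induction n with
    | zero =>
      -- On the degenerate interval `{0}` any field with the right value at `0` is parallel.
      refine ⟨fun τ ↦ frame (γ 0) (γ τ) v, fun t ht ↦ ?_, frame_self (E := E) (γ 0) v⟩
      rw [hσ0, Icc_self, mem_singleton_iff] at ht
      subst ht
      rw [hσ0, Icc_self]
      exact HasFDerivWithinAt.singleton
    | succ n ih =>
      obtain ⟨V, hV, hV0⟩ := ih
      obtain ⟨i, hi⟩ := hσ n
      have hle : (σ n : ℝ) ≤ σ (n + 1) := hσm (Nat.le_succ n)
      obtain ⟨W, hW, hW0⟩ := hloc i (σ n) (σ (n + 1)) hle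
        (fun τ hτ ↦ by
          have hτJ : τ ∈ Icc (0 : ℝ) 1 := ⟨(σ n).2.1.trans hτ.1, hτ.2.trans (σ (n + 1)).2.2⟩
          exact ⟨hi (show (⟨τ, hτJ⟩ : Icc (0 : ℝ) 1) ∈ Icc (σ n) (σ (n + 1)) from hτ), hτJ⟩)
        (V (σ n))
      obtain ⟨Y, hY, hY0⟩ := hV.glue (σ n).2.1 hle hW hW0
      exact ⟨Y, hY, hY0.trans hV0⟩
  have h1 := key N
  rwa [hN N le_rfl] at h1

/-- Both terms of the product rule vanish. This single fact gives uniqueness of parallel fields and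
the isometry of transport. -/
theorem IsParallelAlong.inner_eq (hγ : ContMDiffOn 𝓘(ℝ) 𝓘(ℝ, E) ∞ γ (Icc 0 1))
    {V W : ∀ τ, TangentSpace 𝓘(ℝ, E) (γ τ)} (hV : IsParallelAlong γ V (Icc 0 1))
    (hW : IsParallelAlong γ W (Icc 0 1)) {t : ℝ} (ht : t ∈ Icc (0 : ℝ) 1) :
    inner ℝ (V t) (W t) = inner ℝ (V 0) (W 0) := by
  have h1 : ∀ t ∈ Icc (0 : ℝ) 1, HasDerivWithinAt (fun τ ↦ inner ℝ (V τ) (W τ)) 0 (Icc 0 1) t := by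
    intro t ht
    have h2 := (hV t ht).hasDerivWithinAt_inner (hasVelocityWithinAt_velocity
      ((hγ t ht).mdifferentiableWithinAt (by simp))) (hW t ht)
    simpa using h2
  exact constant_of_has_deriv_right_zero (fun t ht ↦ (h1 t ht).continuousWithinAt)
    (fun t ht ↦ (h1 t (Ico_subset_Icc_self ht)).mono_of_mem_nhdsWithin
      (Icc_mem_nhdsGE_of_mem ht)) t ht

theorem IsParallelAlong.add (hγ : ContMDiffOn 𝓘(ℝ) 𝓘(ℝ, E) ∞ γ (Icc 0 1))
    {V W : ∀ τ, TangentSpace 𝓘(ℝ, E) (γ τ)} (hV : IsParallelAlong γ V (Icc 0 1))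
    (hW : IsParallelAlong γ W (Icc 0 1)) :
    IsParallelAlong γ (fun τ ↦ V τ + W τ) (Icc 0 1) := fun t ht ↦ by
  simpa using (hV t ht).add (hγ.continuousOn t ht) (hW t ht)

theorem IsParallelAlong.const_smul (hγ : ContMDiffOn 𝓘(ℝ) 𝓘(ℝ, E) ∞ γ (Icc 0 1))
    {V : ∀ τ, TangentSpace 𝓘(ℝ, E) (γ τ)} (hV : IsParallelAlong γ V (Icc 0 1)) (k : ℝ) :
    IsParallelAlong γ (fun τ ↦ k • V τ) (Icc 0 1) := fun t ht ↦ by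
  simpa using (hV t ht).const_smul (hγ.continuousOn t ht) k

/-- The difference is parallel and vanishes at `0`, and its norm is constant, so no ODE uniqueness
is needed. -/
theorem IsParallelAlong.eqOn (hγ : ContMDiffOn 𝓘(ℝ) 𝓘(ℝ, E) ∞ γ (Icc 0 1))
    {V W : ∀ τ, TangentSpace 𝓘(ℝ, E) (γ τ)} (hV : IsParallelAlong γ V (Icc 0 1))
    (hW : IsParallelAlong γ W (Icc 0 1)) (h0 : V 0 = W 0) {t : ℝ} (ht : t ∈ Icc (0 : ℝ) 1) :
    V t = W t := by
  have h1 := hV.add hγ (hW.const_smul hγ (-1))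
  have h2 := h1.inner_eq hγ h1 ht
  rw [h0, neg_one_smul, neg_one_smul, add_neg_cancel, inner_zero_left, inner_self_eq_zero] at h2
  exact eq_of_sub_eq_zero ((sub_eq_add_neg _ _).trans h2)

/-- Parallel transport along a smooth curve on `[0, 1]`, from time `0` to all times. -/
theorem exists_parallel_frame (hγ : ContMDiffOn 𝓘(ℝ) 𝓘(ℝ, E) ∞ γ (Icc 0 1)) :
    ∃ T : ∀ t, TangentSpace 𝓘(ℝ, E) (γ 0) →L[ℝ] TangentSpace 𝓘(ℝ, E) (γ t),
      (∀ v, IsParallelAlong γ (fun t ↦ T t v) (Icc 0 1)) ∧ ∀ v, T 0 v = v := by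
  classical
  choose V hV hV0 using exists_isParallelAlong hγ
  have hadd : ∀ v w, ∀ t ∈ Icc (0 : ℝ) 1, V (v + w) t = V v t + V w t := fun v w t ht ↦
    (hV (v + w)).eqOn hγ ((hV v).add hγ (hV w)) (by rw [hV0, hV0, hV0]) ht
  have hsmul : ∀ (k : ℝ) v, ∀ t ∈ Icc (0 : ℝ) 1, V (k • v) t = k • V v t := fun k v t ht ↦
    (hV (k • v)).eqOn hγ ((hV v).const_smul hγ k) (by rw [hV0, hV0]) ht
  let T : ∀ t, TangentSpace 𝓘(ℝ, E) (γ 0) →L[ℝ] TangentSpace 𝓘(ℝ, E) (γ t) := fun t ↦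
    if ht : t ∈ Icc (0 : ℝ) 1 then LinearMap.toContinuousLinearMap
      { toFun := fun v ↦ V v t
        map_add' := fun v w ↦ hadd v w t ht
        map_smul' := fun k v ↦ hsmul k v t ht }
    else 0
  have hT : ∀ v, ∀ t ∈ Icc (0 : ℝ) 1, T t v = V v t := by
    intro v t ht
    simp only [T, dif_pos ht]
    rfl
  exact ⟨T, fun v t ht ↦ (hV v t ht).congr (hT v) ht,
    fun v ↦ (hT v 0 (left_mem_Icc.2 zero_le_one)).trans (hV0 v)⟩

end Parallel

/-! ### Identification of the chosen parallel transport -/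

section Transport

variable {E : Type*} [NormedAddCommGroup E] [NormedSpace ℝ E] [FiniteDimensional ℝ E]
  {M : Type*} [TopologicalSpace M] [ChartedSpace E M] [IsManifold 𝓘(ℝ, E) ∞ M]
  [RiemannianBundle (fun x : M ↦ TangentSpace 𝓘(ℝ, E) x)]
  [IsContMDiffRiemannianBundle 𝓘(ℝ, E) ∞ E (fun x : M ↦ TangentSpace 𝓘(ℝ, E) x)]

theorem covDerivAlong_eq_zero_congr {Z Z' : ℝ → TangentBundle 𝓘(ℝ, E) M} {J : Set ℝ}
    (h : EqOn Z' Z J) {t : ℝ} (ht : t ∈ J) (hZ : covDerivAlong Z J t = 0) :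
    covDerivAlong Z' J t = 0 := by
  -- Agreement on `J` does not identify the types of the two covariant derivatives, which live over
  -- `Z t` and `Z' t`. The predicate `Q` takes the base vector as an argument and `E`-valued data,
  -- so the equalities can be rewritten.
  let Q (b : TangentBundle 𝓘(ℝ, E) M) (u d : E) : Prop :=
    (show TangentSpace 𝓘(ℝ, E) b.proj from d) +
      christoffel b.proj (show TangentSpace 𝓘(ℝ, E) b.proj from u) b.snd = 0
  let u (Z : ℝ → TangentBundle 𝓘(ℝ, E) M) : E := velocity (fun τ ↦ (Z τ).proj) J t
  let d (Z : ℝ → TangentBundle 𝓘(ℝ, E) M) : E :=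
    derivWithin (fun τ ↦ coord (Z t).proj (Z τ)) J t
  have hu : u Z' = u Z := by
    have h1 := mfderivWithin_congr_of_mem (I := 𝓘(ℝ)) (I' := 𝓘(ℝ, E)) (f := fun τ ↦ (Z τ).proj)
      (f₁ := fun τ ↦ (Z' τ).proj) (s := J) (fun τ hτ ↦ congrArg TotalSpace.proj (h hτ)) ht
    exact congrArg (fun A : ℝ →L[ℝ] E ↦ A 1) h1
  have hd : d Z' = d Z := by
    simp only [d]
    rw [h ht]
    exact derivWithin_congr (fun τ hτ ↦ by rw [h hτ]) (by rw [h ht])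
  have h2 : Q (Z t) (u Z) (d Z) := hZ
  rw [← h ht, ← hu, ← hd] at h2
  exact h2

theorem IsParallelOn.congr {Z Z' : ℝ → TangentBundle 𝓘(ℝ, E) M} {J : Set ℝ}
    (hZ : IsParallelOn Z J) (h : EqOn Z' Z J) : IsParallelOn Z' J :=
  ⟨hZ.1.congr h, fun t ht ↦ covDerivAlong_eq_zero_congr h ht (hZ.2 t ht)⟩

/-- A parallel field along `γ` given as a curve in the tangent bundle comes from a parallel field
given as a dependent function. -/
theorem IsParallelOn.exists_isParallelAlong {γ : ℝ → M} {Z : ℝ → TangentBundle 𝓘(ℝ, E) M}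
    (hZ : IsParallelOn Z (Icc 0 1)) (hp : ∀ t ∈ Icc (0 : ℝ) 1, (Z t).proj = γ t) :
    ∃ V : ∀ τ, TangentSpace 𝓘(ℝ, E) (γ τ), IsParallelAlong γ V (Icc 0 1) ∧
      ∀ t ∈ Icc (0 : ℝ) 1, Z t = ⟨γ t, V t⟩ := by
  classical
  -- Changing `Z` off `[0, 1]` makes its projection equal to `γ` as a function, so `γ` can be
  -- substituted away.
  let Z' : ℝ → TangentBundle 𝓘(ℝ, E) M := fun τ ↦ if τ ∈ Icc (0 : ℝ) 1 then Z τ else ⟨γ τ, 0⟩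
  have h1 : EqOn Z' Z (Icc 0 1) := fun τ hτ ↦ if_pos hτ
  have h2 : γ = fun τ ↦ (Z' τ).proj := by
    funext τ
    by_cases hτ : τ ∈ Icc (0 : ℝ) 1
    · rw [h1 hτ, hp τ hτ]
    · simp only [Z', if_neg hτ]
  have h3 := hZ.congr h1
  clear_value Z'
  subst h2
  refine ⟨fun τ ↦ (Z' τ).snd, fun t ht ↦ ?_, fun t ht ↦ (h1 ht).symm⟩
  have h4 := hasCovDerivWithinAt_covDerivAlong (c := fun τ ↦ (Z' τ).proj)
    (V := fun τ ↦ (Z' τ).snd) (h3.1 t ht)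
  have h5 := h3.2 t ht
  exact h5 ▸ h4

theorem IsParallelAlong.isParallelOn {γ : ℝ → M} (hγ : ContMDiffOn 𝓘(ℝ) 𝓘(ℝ, E) ∞ γ (Icc 0 1))
    {V : ∀ τ, TangentSpace 𝓘(ℝ, E) (γ τ)} (hV : IsParallelAlong γ V (Icc 0 1)) :
    IsParallelOn (fun τ ↦ (⟨γ τ, V τ⟩ : TangentBundle 𝓘(ℝ, E) M)) (Icc 0 1) := by
  have hvel : ∀ t ∈ Icc (0 : ℝ) 1, HasVelocityWithinAt (E := E) γ (Icc 0 1) t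
      (velocity γ (Icc 0 1) t) := fun t ht ↦
    hasVelocityWithinAt_velocity ((hγ t ht).mdifferentiableWithinAt (by simp))
  exact ⟨fun t ht ↦ (hV t ht).mdifferentiableWithinAt (hvel t ht),
    fun t ht ↦ (hV t ht).covDerivAlong_eq (hvel t ht) (uniqueDiffOn_Icc one_pos t ht)⟩

theorem mapsTo_mul_left_unitIcc {k : ℝ} (hk : k ∈ Icc (0 : ℝ) 1) :
    MapsTo (fun τ ↦ k * τ) (Icc (0 : ℝ) 1) (Icc 0 1) := fun _ hτ ↦
  ⟨mul_nonneg hk.1 hτ.1, mul_le_one₀ hk.2 hτ.1 hτ.2⟩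

theorem contMDiffOn_comp_mul_left {γ : ℝ → M} (hγ : ContMDiffOn 𝓘(ℝ) 𝓘(ℝ, E) ∞ γ (Icc 0 1))
    {k : ℝ} (hk : k ∈ Icc (0 : ℝ) 1) :
    ContMDiffOn 𝓘(ℝ) 𝓘(ℝ, E) ∞ (fun τ ↦ γ (k * τ)) (Icc 0 1) := by
  have h1 : ContMDiff 𝓘(ℝ) 𝓘(ℝ) ∞ (fun τ : ℝ ↦ k * τ) :=
    (contDiff_const.mul contDiff_id).contMDiff
  exact hγ.comp h1.contMDiffOn (mapsTo_mul_left_unitIcc hk)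

theorem IsParallelAlong.comp_mul_left {γ : ℝ → M}
    (hγ : ContMDiffOn 𝓘(ℝ) 𝓘(ℝ, E) ∞ γ (Icc 0 1))
    {V : ∀ τ, TangentSpace 𝓘(ℝ, E) (γ τ)} (hV : IsParallelAlong γ V (Icc 0 1)) {k : ℝ}
    (hk : k ∈ Icc (0 : ℝ) 1) :
    IsParallelAlong (fun τ ↦ γ (k * τ)) (fun τ ↦ V (k * τ)) (Icc 0 1) := by
  intro t ht
  have hmaps := mapsTo_mul_left_unitIcc hk
  have h1 := (hasVelocityWithinAt_velocity ((hγ _ (hmaps ht)).mdifferentiableWithinAt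
    (by simp))).comp_mul_left hmaps
  have h2 := (hV _ (hmaps ht)).comp_mul_left hmaps
  rw [h1.velocity_eq (uniqueDiffOn_Icc one_pos t ht)]
  rwa [smul_zero] at h2

/-- The map `parallelTransport` is computed by parallel fields. -/
theorem parallelTransport_eq {γ : ℝ → M} (hγ : ContMDiffOn 𝓘(ℝ) 𝓘(ℝ, E) ∞ γ (Icc 0 1))
    {T : ∀ t, TangentSpace 𝓘(ℝ, E) (γ 0) →L[ℝ] TangentSpace 𝓘(ℝ, E) (γ t)}
    (hT : ∀ v, IsParallelAlong γ (fun t ↦ T t v) (Icc 0 1)) (hT0 : ∀ v, T 0 v = v)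
    {k : ℝ} (hk : k ∈ Icc (0 : ℝ) 1) {c : ℝ → M} (hc : ∀ τ ∈ Icc (0 : ℝ) 1, c τ = γ (k * τ)) :
    parallelTransport c (γ 0) (γ k) = T k := by
  have hγk := contMDiffOn_comp_mul_left hγ hk
  have hTk := fun v ↦ (hT v).comp_mul_left hγ hk
  have hend : ∀ v, (⟨γ (k * 1), T (k * 1) v⟩ : TangentBundle 𝓘(ℝ, E) M) = ⟨γ k, T k v⟩ := by
    intro v
    rw [mul_one]
  have hstart : ∀ v, (⟨γ (k * 0), T (k * 0) v⟩ : TangentBundle 𝓘(ℝ, E) M) = ⟨γ 0, v⟩ := by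
    intro v
    rw [mul_zero, hT0]
  have hex : ∃ P, IsParallelTransport c (γ 0) (γ k) P :=
    ⟨T k, fun v ↦ ⟨fun τ ↦ ⟨γ (k * τ), T (k * τ) v⟩, (hTk v).isParallelOn hγk,
      fun t ht ↦ (hc t ht).symm, hstart v, hend v⟩⟩
  rw [parallelTransport, dif_pos hex]
  -- The chosen transport and `T k` are endpoint values of parallel fields along the same rescaled
  -- curve with the same initial vector.
  ext v
  obtain ⟨Z, hZ, hZc, hZ0, hZ1⟩ := hex.choose_spec v
  obtain ⟨V, hV, hVZ⟩ := hZ.exists_isParallelAlong (γ := fun τ ↦ γ (k * τ))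
    fun t ht ↦ (hZc t ht).trans (hc t ht)
  have h0 : V 0 = T (k * 0) v := by
    have h1 := (hVZ 0 (left_mem_Icc.2 zero_le_one)).symm.trans (hZ0.trans (hstart v).symm)
    exact TotalSpace.mk_inj.1 h1
  have h1 := hV.eqOn hγk (hTk v) h0 (right_mem_Icc.2 zero_le_one)
  have h2 : (⟨γ k, hex.choose v⟩ : TangentBundle 𝓘(ℝ, E) M) = ⟨γ k, T k v⟩ := by
    rw [← hZ1, hVZ 1 (right_mem_Icc.2 zero_le_one), ← hend v]
    exact TotalSpace.mk_inj.2 h1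
  exact TotalSpace.mk_inj.1 h2

theorem inner_parallel_frame {γ : ℝ → M} (hγ : ContMDiffOn 𝓘(ℝ) 𝓘(ℝ, E) ∞ γ (Icc 0 1))
    {T : ∀ t, TangentSpace 𝓘(ℝ, E) (γ 0) →L[ℝ] TangentSpace 𝓘(ℝ, E) (γ t)}
    (hT : ∀ v, IsParallelAlong γ (fun t ↦ T t v) (Icc 0 1)) (hT0 : ∀ v, T 0 v = v)
    {t : ℝ} (ht : t ∈ Icc (0 : ℝ) 1) (v w : TangentSpace 𝓘(ℝ, E) (γ 0)) :
    inner ℝ (T t v) (T t w) = inner ℝ v w := by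
  have h1 := (hT v).inner_eq hγ (hT w) ht
  rwa [hT0, hT0] at h1

theorem isInvertible_of_inner_map {x y : M}
    {P : TangentSpace 𝓘(ℝ, E) x →L[ℝ] TangentSpace 𝓘(ℝ, E) y}
    (hP : ∀ v w, inner ℝ (P v) (P w) = inner ℝ v w) : P.IsInvertible := by
  have hinj : Function.Injective P := by
    rw [injective_iff_map_eq_zero]
    intro v hv
    have h1 := hP v v
    rwa [hv, inner_zero_left, eq_comm, inner_self_eq_zero] at h1
  have hdim : Module.finrank ℝ (TangentSpace 𝓘(ℝ, E) x) =
      Module.finrank ℝ (TangentSpace 𝓘(ℝ, E) y) := rfl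
  refine ⟨(LinearEquiv.ofInjectiveOfFinrankEq
    (P : TangentSpace 𝓘(ℝ, E) x →ₗ[ℝ] TangentSpace 𝓘(ℝ, E) y) hinj hdim).toContinuousLinearEquiv,
    ?_⟩
  ext v
  rfl

theorem inner_inverse_left {x y : M}
    {P : TangentSpace 𝓘(ℝ, E) x →L[ℝ] TangentSpace 𝓘(ℝ, E) y}
    (hP : ∀ v w, inner ℝ (P v) (P w) = inner ℝ v w) (w : TangentSpace 𝓘(ℝ, E) y)
    (v : TangentSpace 𝓘(ℝ, E) x) : inner ℝ (P.inverse w) v = inner ℝ w (P v) := by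
  rw [← hP, (isInvertible_of_inner_map hP).self_apply_inverse]

end Transport

/-! ### The Taylor estimates along a geodesic -/

section Taylor

/-- A function on `[0, 1]` which vanishes at `0` and whose derivative is bounded by `C * t ^ n`
is bounded by `C / (n + 1) * t ^ (n + 1)`. -/
theorem abs_le_of_abs_deriv_le_pow {φ φ' : ℝ → ℝ} {C : ℝ} {n : ℕ} (h0 : φ 0 = 0)
    (hφ : ∀ t ∈ Icc (0 : ℝ) 1, HasDerivWithinAt φ (φ' t) (Icc 0 1) t)
    (hbound : ∀ t ∈ Icc (0 : ℝ) 1, |φ' t| ≤ C * t ^ n) {t : ℝ} (ht : t ∈ Icc (0 : ℝ) 1) :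
    |φ t| ≤ C / (n + 1) * t ^ (n + 1) := by
  have hB : ∀ t : ℝ, HasDerivAt (fun t ↦ C / (n + 1) * t ^ (n + 1)) (C * t ^ n) t := by
    intro t
    have h1 := (hasDerivAt_pow (n + 1) t).const_mul (C / (n + 1))
    refine h1.congr_deriv ?_
    have h2 : (n : ℝ) + 1 ≠ 0 := by positivity
    rw [Nat.add_sub_cancel]
    push_cast
    field_simp
  exact image_norm_le_of_norm_deriv_right_le_deriv_boundary
    (fun t ht ↦ (hφ t ht).continuousWithinAt)
    (fun t ht ↦ (hφ t (Ico_subset_Icc_self ht)).mono_of_mem_nhdsWithin (Icc_mem_nhdsGE_of_mem ht))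
    (by simp [h0]) hB (fun t ht ↦ hbound t (Ico_subset_Icc_self ht)) ht

variable {E : Type*} [NormedAddCommGroup E] [NormedSpace ℝ E] [FiniteDimensional ℝ E]
  {M : Type*} [TopologicalSpace M] [ChartedSpace E M] [IsManifold 𝓘(ℝ, E) ∞ M]
  [RiemannianBundle (fun x : M ↦ TangentSpace 𝓘(ℝ, E) x)]
  [IsContMDiffRiemannianBundle 𝓘(ℝ, E) ∞ E (fun x : M ↦ TangentSpace 𝓘(ℝ, E) x)]

theorem mvfderiv_eq_inner_grad (f : M → ℝ) (x : M) (u : TangentSpace 𝓘(ℝ, E) x) :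
    mvfderiv 𝓘(ℝ, E) f x u = inner ℝ (grad f x) u := by
  rw [grad, InnerProductSpace.toDual_symm_apply]

variable {γ : ℝ → M} {T : ∀ t, TangentSpace 𝓘(ℝ, E) (γ 0) →L[ℝ] TangentSpace 𝓘(ℝ, E) (γ t)}

/-- The derivative of the components of the gradient in a parallel frame along a geodesic. -/
theorem TwiceDifferentiable.hasDerivWithinAt_inner_grad {f : M → ℝ}
    (hf : TwiceDifferentiable (E := E) f) (hγ : IsGeodesicOn (E := E) γ (Icc 0 1))
    (hT : ∀ v, IsParallelAlong γ (fun t ↦ T t v) (Icc 0 1)) (hT0 : ∀ v, T 0 v = v)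
    (v : TangentSpace 𝓘(ℝ, E) (γ 0)) {t : ℝ} (ht : t ∈ Icc (0 : ℝ) 1) :
    HasDerivWithinAt (fun τ ↦ inner ℝ (grad f (γ τ)) (T τ v))
      (inner ℝ (((T t).inverse ∘L hess f (γ t) ∘L T t) (velocity γ (Icc 0 1) 0)) v)
      (Icc 0 1) t := by
  have hvel := hγ.hasVelocityWithinAt ht
  have hgrad := hvel.hasCovDerivWithinAt_comp (hf.2 (γ t))
  have h1 := hgrad.hasDerivWithinAt_inner hvel (hT v t ht)
  have hpar : IsParallelAlong γ (fun τ ↦ velocity γ (Icc 0 1) τ) (Icc 0 1) :=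
    fun t ht ↦ hγ.hasCovDerivWithinAt (uniqueDiffOn_Icc one_pos) ht
  have h2 : velocity γ (Icc 0 1) t = T t (velocity γ (Icc 0 1) 0) :=
    hpar.eqOn hγ.1 (hT _) (hT0 _).symm ht
  rw [inner_zero_right, add_zero] at h1
  -- Transport being isometric, its inverse is its adjoint, so `(T t)⁻¹` moves across the inner
  -- product and becomes `T t v`.
  simp only [ContinuousLinearMap.comp_apply]
  rw [inner_inverse_left (inner_parallel_frame hγ.1 hT hT0 ht), ← h2]
  exact h1

theorem taylor_along_geodesic {f : M → ℝ} (hf : TwiceDifferentiable (E := E) f)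
    (hγ : IsGeodesicOn (E := E) γ (Icc 0 1))
    (hT : ∀ v, IsParallelAlong γ (fun t ↦ T t v) (Icc 0 1)) (hT0 : ∀ v, T 0 v = v)
    {s : TangentSpace 𝓘(ℝ, E) (γ 0)} (hs : velocity γ (Icc 0 1) 0 = s) {L : ℝ} (hL : 0 ≤ L)
    (hLip : ∀ t ∈ Icc (0 : ℝ) 1,
      ‖((T t).inverse ∘L hess f (γ t) ∘L T t) - hess f (γ 0)‖ ≤ L * ‖t • s‖) :
    |f (γ 1) - f (γ 0) - inner ℝ s (grad f (γ 0)) - 1 / 2 * inner ℝ s (hess f (γ 0) s)|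
        ≤ L / 6 * ‖s‖ ^ 3 ∧
      ‖(T 1).inverse (grad f (γ 1)) - grad f (γ 0) - hess f (γ 0) s‖ ≤ L / 2 * ‖s‖ ^ 2 := by
  have h0 : (0 : ℝ) ∈ Icc (0 : ℝ) 1 := left_mem_Icc.2 zero_le_one
  have h1 : (1 : ℝ) ∈ Icc (0 : ℝ) 1 := right_mem_Icc.2 zero_le_one
  -- The gradient expansion tested against an arbitrary `v`; both conclusions are instances of it.
  have hgrad : ∀ v, ∀ t ∈ Icc (0 : ℝ) 1,
      |inner ℝ (grad f (γ t)) (T t v) - inner ℝ (grad f (γ 0)) v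
        - t * inner ℝ (hess f (γ 0) s) v| ≤ L * ‖s‖ ^ 2 * ‖v‖ / 2 * t ^ 2 := by
    intro v t ht
    have h2 := abs_le_of_abs_deriv_le_pow (n := 1) (C := L * ‖s‖ ^ 2 * ‖v‖)
      (φ := fun t ↦ inner ℝ (grad f (γ t)) (T t v) - inner ℝ (grad f (γ 0)) v
        - t * inner ℝ (hess f (γ 0) s) v)
      (φ' := fun t ↦ inner ℝ ((((T t).inverse ∘L hess f (γ t) ∘L T t) - hess f (γ 0) :
        TangentSpace 𝓘(ℝ, E) (γ 0) →L[ℝ] TangentSpace 𝓘(ℝ, E) (γ 0)) s) v)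
      (by simp [hT0]) ?_ ?_ ht
    · convert h2 using 2
      norm_num
    · intro t ht
      have h3 := hf.hasDerivWithinAt_inner_grad hγ hT hT0 v ht
      rw [hs] at h3
      have h4 := (h3.sub_const (inner ℝ (grad f (γ 0)) v)).sub
        ((hasDerivWithinAt_id t (Icc 0 1)).mul_const (inner ℝ (hess f (γ 0) s) v))
      refine h4.congr_deriv ?_
      rw [sub_apply, inner_sub_left, one_mul]
    · intro t ht
      have h3 := hLip t ht
      rw [norm_smul, Real.norm_of_nonneg ht.1] at h3
      calc _ ≤ ‖(((T t).inverse ∘L hess f (γ t) ∘L T t) - hess f (γ 0) :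
            TangentSpace 𝓘(ℝ, E) (γ 0) →L[ℝ] TangentSpace 𝓘(ℝ, E) (γ 0)) s‖ * ‖v‖ :=
            abs_real_inner_le_norm _ _
        _ ≤ L * (t * ‖s‖) * ‖s‖ * ‖v‖ := by
            gcongr
            exact (ContinuousLinearMap.le_opNorm _ s).trans (by gcongr)
        _ = L * ‖s‖ ^ 2 * ‖v‖ * t ^ 1 := by ring
  constructor
  · have hvT : ∀ t ∈ Icc (0 : ℝ) 1, velocity γ (Icc 0 1) t = T t s := by
      have hpar : IsParallelAlong γ (fun τ ↦ velocity γ (Icc 0 1) τ) (Icc 0 1) :=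
        fun t ht ↦ hγ.hasCovDerivWithinAt (uniqueDiffOn_Icc one_pos) ht
      exact fun t ht ↦ hpar.eqOn hγ.1 (hT s) (hs.trans (hT0 s).symm) ht
    -- The derivative of the second-order remainder of `f ∘ γ` is the gradient remainder tested
    -- against `s`, so `hgrad s` bounds it and `1/2` becomes `1/6`.
    have h2 := abs_le_of_abs_deriv_le_pow (n := 2) (C := L * ‖s‖ ^ 2 * ‖s‖ / 2)
      (φ := fun t ↦ f (γ t) - f (γ 0) - t * inner ℝ (grad f (γ 0)) s
        - t ^ 2 * (1 / 2 * inner ℝ (hess f (γ 0) s) s))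
      (φ' := fun t ↦ inner ℝ (grad f (γ t)) (T t s) - inner ℝ (grad f (γ 0)) s
        - t * inner ℝ (hess f (γ 0) s) s)
      (by simp) ?_ (hgrad s) h1
    · rw [real_inner_comm (grad f (γ 0)) s, real_inner_comm (hess f (γ 0) s) s]
      simp only [one_mul, one_pow, mul_one] at h2
      refine h2.trans_eq ?_
      push_cast
      ring
    · intro t ht
      have h3 := (hγ.hasVelocityWithinAt ht).hasDerivWithinAt_comp (hf.1 (γ t))
      rw [mvfderiv_eq_inner_grad, hvT t ht] at h3
      have h4 := ((h3.sub_const (f (γ 0))).sub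
        ((hasDerivWithinAt_id t (Icc 0 1)).mul_const (inner ℝ (grad f (γ 0)) s))).sub
        (((hasDerivAt_pow 2 t).hasDerivWithinAt (s := Icc 0 1)).mul_const
          (1 / 2 * inner ℝ (hess f (γ 0) s) s))
      refine h4.congr_deriv ?_
      push_cast
      ring
  · set d := (T 1).inverse (grad f (γ 1)) - grad f (γ 0) - hess f (γ 0) s with hd
    -- Testing against the error vector itself gives `‖d‖² ≤ (L/2) ‖s‖² ‖d‖`; a nonzero factor `‖d‖`
    -- cancels.
    have h2 := hgrad d 1 h1
    rw [one_mul, one_pow, mul_one, ← inner_inverse_left (inner_parallel_frame hγ.1 hT hT0 h1),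
      ← inner_sub_left, ← inner_sub_left, ← hd, real_inner_self_eq_norm_sq,
      abs_of_nonneg (by positivity)] at h2
    by_contra! h3
    have h4 : 0 < ‖d‖ := lt_of_le_of_lt (by positivity) h3
    nlinarith

end Taylor

end RiemannianTaylor

end

/-! ### From a geodesic to the exponential map -/

theorem mainTheorem9 {E : Type*} [NormedAddCommGroup E] [NormedSpace ℝ E] [FiniteDimensional ℝ E]
    {M : Type*} [TopologicalSpace M] [T2Space M] [ChartedSpace E M] [IsManifold 𝓘(ℝ, E) ∞ M]
    [RiemannianBundle (fun x : M ↦ TangentSpace 𝓘(ℝ, E) x)]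
    [IsContMDiffRiemannianBundle 𝓘(ℝ, E) ∞ E (fun x : M ↦ TangentSpace 𝓘(ℝ, E) x)]
    (f : M → ℝ) (hf : RiemannianTaylor.TwiceDifferentiable (E := E) f)
    (x : M) (s : TangentSpace 𝓘(ℝ, E) x) (hs : s ∈ RiemannianTaylor.expDomain x)
    (L : ℝ) (hL : 0 ≤ L)
    (hLip : ∀ t ∈ Set.Icc (0 : ℝ) 1,
      ‖(RiemannianTaylor.expTransportInv x (t • s) ∘L
          RiemannianTaylor.hess f (RiemannianTaylor.expMap x (t • s)) ∘L
          RiemannianTaylor.expTransport x (t • s)) - RiemannianTaylor.hess f x‖ ≤ L * ‖t • s‖) :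
    |f (RiemannianTaylor.expMap x s) - f x - inner ℝ s (RiemannianTaylor.grad f x)
        - 1 / 2 * inner ℝ s (RiemannianTaylor.hess f x s)| ≤ L / 6 * ‖s‖ ^ 3 ∧
      ‖RiemannianTaylor.expTransportInv x s
          (RiemannianTaylor.grad f (RiemannianTaylor.expMap x s))
        - RiemannianTaylor.grad f x - RiemannianTaylor.hess f x s‖ ≤ L / 2 * ‖s‖ ^ 2 := by
  obtain ⟨γ, hγ⟩ := hs
  -- Replacing `x` by `γ 0` puts `s` and the parallel frame in the same tangent space without casts.
  obtain rfl : γ 0 = x := congrArg TotalSpace.proj hγ.2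
  have hvel : RiemannianTaylor.velocity γ (Icc 0 1) 0 = s := TotalSpace.mk_inj.1 hγ.2
  obtain ⟨T, hT, hT0⟩ := RiemannianTaylor.exists_parallel_frame hγ.1.1
  have hexp : ∀ t ∈ Icc (0 : ℝ) 1, RiemannianTaylor.expMap (γ 0) (t • s) = γ t :=
    fun t ht ↦ RiemannianTaylor.expMap_smul_eq hγ ht
  -- The curve `τ ↦ Exp_x(τ (t s))` is `γ (t τ)`, so transport along it is `T t`.
  have htrans : ∀ t ∈ Icc (0 : ℝ) 1, RiemannianTaylor.parallelTransport
      (fun τ : ℝ ↦ RiemannianTaylor.expMap (γ 0) (τ • t • s)) (γ 0) (γ t) = T t :=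
    fun t ht ↦ RiemannianTaylor.parallelTransport_eq hγ.1.1 hT hT0 ht fun τ hτ ↦ by
      rw [smul_smul, mul_comm τ t]
      exact hexp _ (RiemannianTaylor.mapsTo_mul_left_unitIcc ht hτ)
  have hmain := RiemannianTaylor.taylor_along_geodesic hf hγ.1 hT hT0 hvel hL fun t ht ↦ by
    have h1 := hLip t ht
    simp only [RiemannianTaylor.expTransportInv, RiemannianTaylor.expTransport] at h1
    rw [hexp t ht, htrans t ht] at h1
    exact h1
  have h1 : (1 : ℝ) ∈ Icc (0 : ℝ) 1 := right_mem_Icc.2 zero_le_one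
  have hexp1 := hexp 1 h1
  have htrans1 := htrans 1 h1
  rw [one_smul] at hexp1 htrans1
  simp only [RiemannianTaylor.expTransportInv, RiemannianTaylor.expTransport]
  rw [hexp1, htrans1]
  exact hmain
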